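/- Let $h\ge 1$, $\beta\in(0,1]$ and $L>0$, let $\mathcal H^\beta_L([0,1])$ be the set of probability densities $f$ on $[0,1]$ (with respect to Lebesgue measure) with $|f(x)-f(y)|\le L|x-y|^\beta$ for all $x,y\in[0,1]$, and let $\Psi_\varepsilon=e^{-\varepsilon}(e^\varepsilon-1)^2$. For $n\ge1$ and $\varepsilon\ge 0$ let $$R^*(n,\mathcal H^\beta_L([0,1]),\|\cdot\|_h^h,\varepsilon)=\inf_{\mathsf K_1,\dots,\mathsf K_n}\ \inf_{\hat f}\ \sup_{f\in\mathcal H^\beta_L([0,1])}\mathbb E\big[\|f-\hat f(Z^n)\|_h^h\big]$$ be the sequentially interactive $\varepsilon$-locally private minimax risk: $X_1,\dots,X_n$ are i.i.d. with density $f$; given $X_i$ and $Z^{i-1}=(Z_1,\dots,Z_{i-1})$, the output $Z_i$ is drawn from $\mathsf K_i(\cdot\mid X_i,Z^{i-1})$; each $\mathsf K_i$ is a Markov kernel into an arbitrary measurable space with $\mathsf K_i(A\mid x,z^{i-1})\le e^{\varepsilon}\,\mathsf K_i(A\mid x',z^{i-1})$ for all measurable $A$, all $x,x'\in[0,1]$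 and all $z^{i-1}$; and $\hat f$ ranges over all measurable estimators (real functions on $[0,1]$, depending on $Z^n$). Then there is a constant $c>0$, depending only on $\beta$, $L$ and $h$, such that for all $n\ge 1$ and all $\varepsilon\ge 0$ $$R^*(n,\mathcal H^\beta_L([0,1]),\|\cdot\|_h^h,\varepsilon)\ \ge\ c\,\min\Big\{1,\ (n\Psi_\varepsilon)^{-\frac{h\beta}{2\beta+2}}\Big\},$$ where the minimum is $1$ if $\varepsilon=0$. In particular $R^*\ge c\,(n\Psi_\varepsilon)^{-\frac{h\beta}{2\beta+2}}$ whenever $n\Psi_\varepsilon\ge 1$. -/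

import Mathlib

open MeasureTheory ProbabilityTheory
open scoped ENNReal

universe u

noncomputable section

namespace PrivateDensity

/-- `Psi ε = e^{-ε} (e^ε - 1)^2`. -/
def Psi (ε : ℝ) : ℝ := Real.exp (-ε) * (Real.exp ε - 1) ^ 2

/-- The set of probability densities on `[0,1]` (with respect to Lebesgue measure) that are
`β`-Hölder continuous with constant `L`. -/
def HolderDensities (β L : ℝ) : Set (unitInterval → ℝ) :=
  {f | (∀ x, 0 ≤ f x) ∧ ∫ x, f x = 1 ∧
    ∀ x y : unitInterval, |f x - f y| ≤ L * |(x : ℝ) - (y : ℝ)| ^ β}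

/-- The probability distribution on `[0,1]` with density `f`. -/
def densityMeasure (f : unitInterval → ℝ) : Measure unitInterval :=
  (volume : Measure unitInterval).withDensity (fun x => ENNReal.ofReal (f x))

/-- The space `Z 0 × ⋯ × Z (i - 1)` of the outputs of the first `i` users. -/
def Transcript (Z : ℕ → Type u) : ℕ → Type u
  | 0 => PUnit
  | i + 1 => Transcript Z i × Z i

/-- The product σ-algebra on transcripts. -/
@[reducible]
def transcriptMeasurableSpace (Z : ℕ → Type u) (mZ : ∀ i, MeasurableSpace (Z i)) :
    ∀ i, MeasurableSpace (Transcript Z i)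
  | 0 => (inferInstance : MeasurableSpace PUnit)
  | i + 1 => (transcriptMeasurableSpace Z mZ i).prod (mZ i)

instance (Z : ℕ → Type u) [mZ : ∀ i, MeasurableSpace (Z i)] (i : ℕ) :
    MeasurableSpace (Transcript Z i) :=
  transcriptMeasurableSpace Z mZ i

/-- A Markov kernel `K`, which maps an earlier transcript `t : T` and a sample `x : X` to a
distribution on `Z`, is `ε`-locally differentially private if, for every `t`, the mechanism
`x ↦ K (t, x)` is: `K(A | x, t) ≤ e^ε K(A | x', t)` for all `A`, `x`, `x'`. -/
def IsLDP {T X Z : Type*} [MeasurableSpace T] [MeasurableSpace X] [MeasurableSpace Z]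
    (ε : ℝ) (K : Kernel (T × X) Z) : Prop :=
  ∀ (t : T) (x x' : X) (A : Set Z), MeasurableSet A →
    K (t, x) A ≤ ENNReal.ofReal (Real.exp ε) * K (t, x') A

/-- A sequentially interactive `ε`-LDP protocol for users holding samples in `X`: user `i`
(numbered from `0`) releases an element of an arbitrary measurable space `Z i`, drawn from a
distribution that depends on the user's sample and on the outputs of all earlier users. With `n`
users, only the first `n` mechanisms are used. -/
structure Protocol (X : Type) [MeasurableSpace X] (ε : ℝ) where
  Z : ℕ → Type u
  [mZ : ∀ i, MeasurableSpace (Z i)]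
  K : ∀ i, Kernel (Transcript Z i × X) (Z i)
  [markov : ∀ i, IsMarkovKernel (K i)]
  ldp : ∀ i, IsLDP ε (K i)

attribute [instance] Protocol.mZ Protocol.markov

namespace Protocol

variable {X : Type} [MeasurableSpace X] {ε : ℝ}

/-- The conditional law of the output of user `i` given the earlier outputs, when the user's
sample is drawn from `P`: it maps `t` to `∫ K i (· | t, x) P(dx)`. -/
def outputKernel (M : Protocol.{u} X ε) (P : Measure X) (i : ℕ) :
    Kernel (Transcript M.Z i) (M.Z i) :=
  M.K i ∘ₖ (Kernel.id ×ₖ Kernel.const (Transcript M.Z i) P)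

/-- The joint law of the outputs of the first `n` users, when the samples are i.i.d. from `P`. -/
def law (M : Protocol.{u} X ε) (P : Measure X) : ∀ n, Measure (Transcript M.Z n)
  | 0 => Measure.dirac PUnit.unit
  | n + 1 => (M.law P n).compProd (M.outputKernel P n)

instance (M : Protocol.{u} X ε) (P : Measure X) [IsProbabilityMeasure P] (i : ℕ) :
    IsMarkovKernel (M.outputKernel P i) := by
  unfold outputKernel; infer_instance

theorem isProbabilityMeasure_law (M : Protocol.{u} X ε) (P : Measure X)
    [IsProbabilityMeasure P] (n : ℕ) : IsProbabilityMeasure (M.law P n) := by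
  induction n with
  | zero => exact Measure.dirac.isProbabilityMeasure
  | succ n ih =>
    have := ih
    exact (inferInstance :
      IsProbabilityMeasure ((M.law P n).compProd (M.outputKernel P n)))

end Protocol

/-- The loss `‖f - g‖_h^h = ∫_{[0,1]} |f - g|^h`, possibly infinite. -/
def lossPow (h : ℝ) (f g : unitInterval → ℝ) : ℝ≥0∞ :=
  ∫⁻ x, ENNReal.ofReal (|f x - g x| ^ h)

/-- The sequentially interactive private minimax risk
`inf_{K_1, …, K_n ε-LDP} inf_{f̂} sup_f 𝔼 ‖f - f̂(Z^n)‖_h^h`, where `f` ranges over the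
`β`-Hölder densities with constant `L`, and `f̂` over all (measurable) estimators. -/
def minimaxRisk (n : ℕ) (β L h ε : ℝ) : ℝ≥0∞ :=
  ⨅ (M : Protocol.{u} unitInterval ε)
    (fhat : Transcript M.Z n → unitInterval → ℝ) (_ : Measurable (Function.uncurry fhat)),
    ⨆ f ∈ HolderDensities β L, ∫⁻ z, lossPow h f (fhat z) ∂(M.law (densityMeasure f) n)

end PrivateDensity

end

/-! The argument is Assouad's method with Hellinger affinities. The uniform density is perturbed by
`m` sine waves of amplitude `γ` on disjoint intervals of length `1/m`, with signs `θ` in `{±1}^m`.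
An estimator that cannot tell `θ` from its neighbours `flipAt j θ` loses a multiple of `γ^h / m` for
each such `j`, hence of `γ^h` in total.

Privacy enters through one user. Given the past, the probability `k x` of an output event varies
with the sample `x` only within `[e^{-ε} q, e^ε q]`, where `q` is its mean, so its variance is at
most `Psi ε * q ^ 2`. By Cauchy-Schwarz, a mean-zero perturbation `ψ` of the sample density changes
the event's probability by at most `√(‖ψ‖² * Psi ε) * q` (`abs_integral_mul_le_of_ldp`). The `m`
perturbations are orthogonal, so this applies to all their linear combinations at once, and duality
(`ae_sum_sq_le`) bounds the sum over `j` of the squared differences of output densities by `4γ²Ψ/m`.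
This Bessel inequality (`exists_output_densities`) saves a factor `m` over treating each `j`
separately and produces the exponent `2β+2`.

Each user therefore lowers the sum over `j` of the affinities, averaged over `θ`, by at most `γ²Ψ/m`
(`exists_likelihoods`). If `4nγ²Ψ ≤ m²`, the average affinity after `n` users is at least `3/4`, and
`le_minimaxRisk` turns this into a risk of order `γ^h`. The Hölder condition allows `γ ≍ m^{-β}`,
and `m ≍ (nΨ)^{1/(2β+2)}` gives the rate. -/

noncomputable section

namespace PrivateDensity

/-! ### Perturbations of the uniform density -/

/-- The projection of the real line onto `[0,1]`. -/
def clamp (y : ℝ) : ℝ := max 0 (min 1 y)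

/-- One period of the sine function on `[0,1]`, extended by `0`. -/
def bump (y : ℝ) : ℝ := Real.sin (2 * Real.pi * clamp y)

theorem continuous_bump : Continuous bump := by
  unfold bump clamp; fun_prop

theorem abs_bump_le_one (y : ℝ) : |bump y| ≤ 1 := Real.abs_sin_le_one _

theorem bump_of_nonpos {y : ℝ} (hy : y ≤ 0) : bump y = 0 := by
  have : clamp y = 0 := by
    unfold clamp; rw [min_eq_right (by linarith), max_eq_left hy]
  simp [bump, this]

theorem bump_of_one_le {y : ℝ} (hy : 1 ≤ y) : bump y = 0 := by
  have : clamp y = 1 := by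
    unfold clamp; rw [min_eq_left hy, max_eq_right zero_le_one]
  simp [bump, this]

theorem bump_of_mem {y : ℝ} (h0 : 0 ≤ y) (h1 : y ≤ 1) :
    bump y = Real.sin (2 * Real.pi * y) := by
  rw [bump, clamp, min_eq_right h1, max_eq_right h0]

theorem mem_Ioo_of_bump_ne_zero {y : ℝ} (h : bump y ≠ 0) : 0 < y ∧ y < 1 := by
  constructor
  · by_contra! hy
    exact h (bump_of_nonpos hy)
  · by_contra! hy
    exact h (bump_of_one_le hy)

/-- The angle `2πy` then lies in `[π/6, 5π/6]`. This middle third of a period is where two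
neighbouring densities are separated. -/
theorem half_le_bump {y : ℝ} (h0 : 1 / 12 ≤ y) (h1 : y ≤ 5 / 12) : 1 / 2 ≤ bump y := by
  rw [bump_of_mem (by linarith) (by linarith), ← Real.cos_pi_div_two_sub,
    ← Real.cos_pi_div_three, ← Real.cos_abs (Real.pi / 2 - _)]
  have hpi := Real.pi_pos
  refine Real.cos_le_cos_of_nonneg_of_le_pi (abs_nonneg _) (by linarith) ?_
  rw [abs_le]
  constructor <;> nlinarith

theorem abs_bump_sub_le (x y : ℝ) :
    |bump x - bump y| ≤ 2 * Real.pi * |clamp x - clamp y| := by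
  have h : ∀ a b : ℝ, |Real.sin a - Real.sin b| ≤ |a - b| := by
    intro a b
    rw [Real.sin_sub_sin, abs_mul, abs_mul]
    have h1 : |Real.sin ((a - b) / 2)| ≤ |(a - b) / 2| := Real.abs_sin_le_abs
    have h2 := Real.abs_cos_le_one ((a + b) / 2)
    have h3 := abs_nonneg (Real.sin ((a - b) / 2))
    rw [abs_div] at h1
    simp only [abs_two] at *
    nlinarith [abs_nonneg (Real.cos ((a + b) / 2))]
  refine (h _ _).trans_eq ?_
  rw [← mul_sub, abs_mul, abs_of_pos (by positivity)]

theorem clamp_mono : Monotone clamp := fun _ _ h =>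
  max_le_max le_rfl (min_le_min le_rfl h)

/-- The shifted clamps climb one after the other, so together they form the projection onto `[0,
m]`. -/
theorem sum_clamp (m : ℕ) (y : ℝ) :
    ∑ j : Fin m, clamp (y - (j : ℕ)) = max 0 (min (m : ℝ) y) := by
  induction m with
  | zero => simp
  | succ m ih =>
    rw [Fin.sum_univ_castSucc]
    simp only [Fin.val_castSucc, Fin.val_last, ih]
    unfold clamp
    push_cast
    have : (0 : ℝ) ≤ m := Nat.cast_nonneg m
    simp only [max_def, min_def]
    split_ifs <;> linarith

/-- All increments have the same sign by monotonicity, so their absolute values add up to an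
increment of the 1-Lipschitz projection onto `[0, m]`. This gives a Lipschitz bound for sums of
bumps that is free of `m`, with no case distinction on the cells of `x` and `y`. -/
theorem sum_abs_clamp_sub_le (m : ℕ) (x y : ℝ) :
    ∑ j : Fin m, |clamp (x - (j : ℕ)) - clamp (y - (j : ℕ))| ≤ |x - y| := by
  wlog h : y ≤ x generalizing x y
  · have := this y x (by linarith)
    rw [abs_sub_comm x y]
    simpa only [abs_sub_comm] using this
  have h1 : ∀ j : Fin m, |clamp (x - (j : ℕ)) - clamp (y - (j : ℕ))|
      = clamp (x - (j : ℕ)) - clamp (y - (j : ℕ)) := fun j =>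
    abs_of_nonneg (sub_nonneg.2 (clamp_mono (by linarith)))
  simp only [h1, Finset.sum_sub_distrib, sum_clamp]
  rw [abs_of_nonneg (by linarith)]
  have : (0 : ℝ) ≤ m := Nat.cast_nonneg m
  simp only [max_def, min_def]
  split_ifs <;> linarith

theorem bump_sub_eq_zero_of_ne {y : ℝ} {j k : ℕ} (hj : bump (y - j) ≠ 0) (hk : k ≠ j) :
    bump (y - k) = 0 := by
  by_contra h
  have h1 := mem_Ioo_of_bump_ne_zero hj
  have h2 := mem_Ioo_of_bump_ne_zero h
  apply hk
  have h3 : (k : ℝ) < j + 1 := by linarith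
  have h4 : (j : ℝ) < k + 1 := by linarith
  norm_cast at h3 h4
  lia

theorem sum_mul_bump_of_ne {m : ℕ} (c : Fin m → ℝ) {y : ℝ} {j : Fin m}
    (hj : bump (y - (j : ℕ)) ≠ 0) :
    ∑ k : Fin m, c k * bump (y - (k : ℕ)) = c j * bump (y - (j : ℕ)) := by
  refine Finset.sum_eq_single j (fun k _ hk => ?_) (by simp)
  rw [bump_sub_eq_zero_of_ne hj (fun h => hk (Fin.ext h)), mul_zero]

theorem abs_sum_mul_bump_le {m : ℕ} {c : Fin m → ℝ} {C : ℝ} (hC : 0 ≤ C)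
    (hc : ∀ j, |c j| ≤ C) (y : ℝ) : |∑ k : Fin m, c k * bump (y - (k : ℕ))| ≤ C := by
  by_cases h : ∃ j : Fin m, bump (y - (j : ℕ)) ≠ 0
  · obtain ⟨j, hj⟩ := h
    rw [sum_mul_bump_of_ne c hj, abs_mul]
    calc |c j| * |bump (y - (j : ℕ))| ≤ C * 1 :=
          mul_le_mul (hc j) (abs_bump_le_one _) (abs_nonneg _) hC
      _ = C := mul_one C
  · push Not at h
    simpa [h] using hC

/-- The bumps have disjoint supports, so all cross terms vanish: this is the orthogonality of the
perturbations. -/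
theorem sq_sum_mul_bump {m : ℕ} (c : Fin m → ℝ) (y : ℝ) :
    (∑ k : Fin m, c k * bump (y - (k : ℕ))) ^ 2
      = ∑ k : Fin m, c k ^ 2 * bump (y - (k : ℕ)) ^ 2 := by
  by_cases h : ∃ j : Fin m, bump (y - (j : ℕ)) ≠ 0
  · obtain ⟨j, hj⟩ := h
    rw [sum_mul_bump_of_ne c hj, mul_pow]
    symm
    refine Finset.sum_eq_single j (fun k _ hk => ?_) (by simp)
    rw [bump_sub_eq_zero_of_ne hj (fun h => hk (Fin.ext h))]
    simp
  · push Not at h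
    simp [h]

theorem abs_sum_mul_bump_sub_le {m : ℕ} {c : Fin m → ℝ} {C : ℝ} (hC : 0 ≤ C)
    (hc : ∀ j, |c j| ≤ C) (x y : ℝ) :
    |∑ k : Fin m, c k * bump (x - (k : ℕ)) - ∑ k : Fin m, c k * bump (y - (k : ℕ))|
      ≤ C * (2 * Real.pi) * |x - y| := by
  rw [← Finset.sum_sub_distrib]
  calc |∑ k : Fin m, (c k * bump (x - (k : ℕ)) - c k * bump (y - (k : ℕ)))|
      ≤ ∑ k : Fin m, |c k * bump (x - (k : ℕ)) - c k * bump (y - (k : ℕ))| :=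
        Finset.abs_sum_le_sum_abs _ _
    _ ≤ ∑ k : Fin m, C * (2 * Real.pi) * |clamp (x - (k : ℕ)) - clamp (y - (k : ℕ))| := by
        refine Finset.sum_le_sum fun k _ => ?_
        rw [← mul_sub, abs_mul, mul_assoc]
        exact mul_le_mul (hc k) (abs_bump_sub_le _ _) (abs_nonneg _) hC
    _ ≤ C * (2 * Real.pi) * |x - y| := by
        rw [← Finset.mul_sum]
        have := Real.pi_pos
        exact mul_le_mul_of_nonneg_left (sum_abs_clamp_sub_le m x y) (by positivity)

/-! ### Integrals of the rescaled bumps -/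

theorem integral_unitInterval (g : ℝ → ℝ) :
    ∫ x : unitInterval, g x = ∫ x in (0 : ℝ)..1, g x := by
  rw [intervalIntegral.integral_of_le zero_le_one, ← integral_Icc_eq_integral_Ioc]
  exact integral_subtype measurableSet_Icc g

/-- The substitution `y = m x - j` maps `[0,1]` onto `[-j, m-j]`, which contains `[0,1]`; outside
`[0,1]` the integrand is `F 0 = 0`. -/
theorem intervalIntegral_comp_bump {m : ℕ} (j : Fin m) {F : ℝ → ℝ} (hF : Continuous F)
    (hF0 : F 0 = 0) :
    ∫ x in (0 : ℝ)..1, F (bump (m * x - (j : ℕ)))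
      = (m : ℝ)⁻¹ * ∫ y in (0 : ℝ)..1, F (bump y) := by
  have hm : (m : ℝ) ≠ 0 := by
    have := j.pos
    positivity
  have hj : ((j : ℕ) : ℝ) + 1 ≤ m := by exact_mod_cast j.2
  rw [intervalIntegral.integral_comp_mul_sub (fun y => F (bump y)) hm]
  have hi : ∀ a b : ℝ, IntervalIntegrable (fun y => F (bump y)) volume a b := fun a b =>
    (hF.comp continuous_bump).intervalIntegrable a b
  have h1 : ∫ y in ((m : ℝ) * 0 - (j : ℕ))..0, F (bump y) = 0 := by
    refine intervalIntegral.integral_zero_ae (.of_forall fun y hy => ?_)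
    rw [Set.uIoc_of_le (by simp)] at hy
    rw [bump_of_nonpos hy.2, hF0]
  have h2 : ∫ y in (1 : ℝ)..((m : ℝ) * 1 - (j : ℕ)), F (bump y) = 0 := by
    refine intervalIntegral.integral_zero_ae (.of_forall fun y hy => ?_)
    rw [Set.uIoc_of_le (by linarith)] at hy
    rw [bump_of_one_le hy.1.le, hF0]
  rw [← intervalIntegral.integral_add_adjacent_intervals (hi _ 0) (hi 0 _),
    ← intervalIntegral.integral_add_adjacent_intervals (hi 0 1) (hi 1 _), h1, h2]
  simp

theorem integral_bump_eq_zero {m : ℕ} (j : Fin m) :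
    ∫ x : unitInterval, bump (m * x - (j : ℕ)) = 0 := by
  rw [integral_unitInterval (fun x => bump (m * x - (j : ℕ))),
    intervalIntegral_comp_bump j (F := fun y => y) continuous_id rfl]
  have h : ∫ y in (0 : ℝ)..1, bump y = ∫ y in (0 : ℝ)..1, Real.sin (2 * Real.pi * y) := by
    refine intervalIntegral.integral_congr fun y hy => ?_
    rw [Set.uIcc_of_le zero_le_one] at hy
    exact bump_of_mem hy.1 hy.2
  rw [h, intervalIntegral.integral_comp_mul_left (fun y => Real.sin y)
    (by positivity : 2 * Real.pi ≠ 0), integral_sin]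
  simp

theorem integral_bump_sq_le {m : ℕ} (j : Fin m) :
    ∫ x : unitInterval, bump (m * x - (j : ℕ)) ^ 2 ≤ (m : ℝ)⁻¹ := by
  rw [integral_unitInterval (fun x => bump (m * x - (j : ℕ)) ^ 2),
    intervalIntegral_comp_bump j (F := fun y => y ^ 2) (by fun_prop) (by simp)]
  refine mul_le_of_le_one_right (by positivity) ?_
  calc ∫ y in (0 : ℝ)..1, bump y ^ 2 ≤ ∫ _ in (0 : ℝ)..1, (1 : ℝ) := by
        refine intervalIntegral.integral_mono_on zero_le_one
          ((continuous_bump.pow 2).intervalIntegrable _ _) (by simp) fun y _ => ?_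
        exact (sq_le_one_iff_abs_le_one _).2 (abs_bump_le_one y)
    _ = 1 := by simp

/-- The sign `±1` encoded by a Boolean. -/
def boolSign (b : Bool) : ℝ := if b then 1 else -1

theorem abs_boolSign (b : Bool) : |boolSign b| = 1 := by cases b <;> simp [boolSign]

theorem boolSign_not (b : Bool) : boolSign (!b) = -boolSign b := by cases b <;> simp [boolSign]

/-- The vertex of the cube obtained from `θ` by changing the coordinate `j`. -/
def flipAt {m : ℕ} (j : Fin m) (θ : Fin m → Bool) : Fin m → Bool :=
  Function.update θ j (!θ j)

theorem flipAt_involutive {m : ℕ} (j : Fin m) : Function.Involutive (flipAt j) := by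
  intro θ
  simp [flipAt]

theorem sum_flipAt {m : ℕ} (j : Fin m) {α : Type*} [AddCommMonoid α]
    (F : (Fin m → Bool) → α) : ∑ θ, F (flipAt j θ) = ∑ θ, F θ :=
  Equiv.sum_comp (flipAt_involutive j).toPerm F

/-- The uniform density on `[0,1]`, perturbed on the interval `[j/m, (j+1)/m]` by a sine wave
of amplitude `γ` and sign `θ j`. -/
def cubeDensity (m : ℕ) (γ : ℝ) (θ : Fin m → Bool) (x : unitInterval) : ℝ :=
  1 + ∑ j : Fin m, γ * boolSign (θ j) * bump (m * x - (j : ℕ))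

/-! ### The cube of densities: orthogonality, Hölder membership, separation -/

section cubeDensity

variable {m : ℕ} {γ : ℝ}

theorem continuous_cubeDensity (θ : Fin m → Bool) : Continuous (cubeDensity m γ θ) := by
  have := continuous_bump
  unfold cubeDensity
  fun_prop

theorem abs_cubeDensity_sub_one_le (hγ : 0 ≤ γ) (θ : Fin m → Bool) (x : unitInterval) :
    |cubeDensity m γ θ x - 1| ≤ γ := by
  rw [cubeDensity, add_sub_cancel_left]
  exact abs_sum_mul_bump_le hγ (fun j => by rw [abs_mul, abs_boolSign, abs_of_nonneg hγ, mul_one]) _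

theorem integrable_of_continuous {g : unitInterval → ℝ} (hg : Continuous g) :
    Integrable g (volume : Measure unitInterval) :=
  hg.integrable_of_hasCompactSupport (HasCompactSupport.of_compactSpace g)

theorem integral_cubeDensity (θ : Fin m → Bool) : ∫ x, cubeDensity m γ θ x = 1 := by
  have hb := continuous_bump
  unfold cubeDensity
  rw [integral_add (integrable_const _)
    (integrable_of_continuous (by fun_prop)), integral_finsetSum]
  · simp [integral_const_mul, integral_bump_eq_zero]
  · exact fun j _ => integrable_of_continuous (by fun_prop)

theorem cubeDensity_sub_flipAt (θ : Fin m → Bool) (j : Fin m) (x : unitInterval) :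
    cubeDensity m γ θ x - cubeDensity m γ (flipAt j θ) x
      = 2 * γ * boolSign (θ j) * bump (m * x - (j : ℕ)) := by
  unfold cubeDensity
  rw [add_sub_add_left_eq_sub, ← Finset.sum_sub_distrib]
  rw [Finset.sum_eq_single j]
  · simp only [flipAt, Function.update_self, boolSign_not]
    ring
  · intro k _ hk
    simp [flipAt, Function.update_of_ne hk]
  · simp

theorem integral_sq_sum_cubeDensity_sub_flipAt_le (θ : Fin m → Bool) (a : Fin m → ℝ) :
    ∫ x, (∑ j, a j * (cubeDensity m γ θ x - cubeDensity m γ (flipAt j θ) x)) ^ 2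
      ≤ 4 * γ ^ 2 * (m : ℝ)⁻¹ * ∑ j, a j ^ 2 := by
  have hb := continuous_bump
  have h : ∀ x : unitInterval,
      (∑ j, a j * (cubeDensity m γ θ x - cubeDensity m γ (flipAt j θ) x)) ^ 2
        = ∑ j : Fin m, 4 * γ ^ 2 * a j ^ 2 * bump (m * x - (j : ℕ)) ^ 2 := by
    intro x
    simp only [cubeDensity_sub_flipAt, ← mul_assoc]
    rw [sq_sum_mul_bump (fun j => a j * 2 * γ * boolSign (θ j))]
    refine Finset.sum_congr rfl fun j _ => ?_
    have : boolSign (θ j) ^ 2 = 1 := by rw [← sq_abs, abs_boolSign, one_pow]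
    linear_combination 4 * a j ^ 2 * γ ^ 2 * bump (m * x - (j : ℕ)) ^ 2 * this
  simp only [h]
  rw [integral_finsetSum _ fun j _ => integrable_of_continuous (by fun_prop), Finset.mul_sum]
  refine Finset.sum_le_sum fun j _ => ?_
  rw [integral_const_mul]
  calc 4 * γ ^ 2 * a j ^ 2 * ∫ x : unitInterval, bump (m * x - (j : ℕ)) ^ 2
      ≤ 4 * γ ^ 2 * a j ^ 2 * (m : ℝ)⁻¹ :=
        mul_le_mul_of_nonneg_left (integral_bump_sq_le j) (by positivity)
    _ = _ := by ring

theorem cubeDensity_mem_holderDensities {β L : ℝ} (hβ : 0 < β) (hβ' : β ≤ 1) (hm : 1 ≤ m)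
    (hγ : 0 ≤ γ) (hγ1 : γ ≤ 1) (hγL : 2 * Real.pi * γ * (m : ℝ) ^ β ≤ L)
    (θ : Fin m → Bool) : cubeDensity m γ θ ∈ HolderDensities β L := by
  refine ⟨fun x => ?_, integral_cubeDensity θ, fun x y => ?_⟩
  · have := (abs_le.1 (abs_cubeDensity_sub_one_le hγ θ x)).1
    linarith
  · have hm0 : (0 : ℝ) < m := by exact_mod_cast hm
    have h1 : |cubeDensity m γ θ x - cubeDensity m γ θ y|
        ≤ 2 * Real.pi * γ * (m * |(x : ℝ) - y|) := by
      have := abs_sum_mul_bump_sub_le (c := fun j : Fin m => γ * boolSign (θ j)) hγ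
        (fun j => by rw [abs_mul, abs_boolSign, abs_of_nonneg hγ, mul_one]) (m * x) (m * y)
      rw [cubeDensity, cubeDensity, add_sub_add_left_eq_sub]
      refine this.trans_eq ?_
      rw [← mul_sub, abs_mul, abs_of_pos hm0]
      ring
    have h2 : |cubeDensity m γ θ x - cubeDensity m γ θ y| ≤ 2 * γ := by
      have h3 := abs_le.1 (abs_cubeDensity_sub_one_le hγ θ x)
      have h4 := abs_le.1 (abs_cubeDensity_sub_one_le hγ θ y)
      rw [abs_le]
      constructor <;> linarith
    have hpi : 2 * γ ≤ 2 * Real.pi * γ := by nlinarith [Real.pi_gt_three]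
    -- Interpolation: the Lipschitz bound serves when `m|x-y| ≤ 1`, where `t ≤ t^β` because `β ≤ 1`;
    -- the uniform bound `2γ` serves otherwise.
    have h5 : |cubeDensity m γ θ x - cubeDensity m γ θ y|
        ≤ 2 * Real.pi * γ * (m * |(x : ℝ) - y|) ^ β := by
      rcases le_total (m * |(x : ℝ) - y|) 1 with h | h
      · refine h1.trans (mul_le_mul_of_nonneg_left ?_ (by linarith))
        exact Real.self_le_rpow_of_le_one (by positivity) h hβ'
      · refine (h2.trans hpi).trans (le_mul_of_one_le_right (by linarith) ?_)
        exact Real.one_le_rpow h hβ.le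
    refine h5.trans ?_
    rw [Real.mul_rpow hm0.le (abs_nonneg _), ← mul_assoc]
    exact mul_le_mul_of_nonneg_right hγL (by positivity)

/-- The part of `[j/m, (j+1)/m]` on which `|cubeDensity m γ θ - cubeDensity m γ (flipAt j θ)|` is
at least `γ`. -/
def bumpSet {m : ℕ} (j : Fin m) : Set unitInterval :=
  {x | 1 / 12 ≤ m * (x : ℝ) - (j : ℕ) ∧ m * (x : ℝ) - (j : ℕ) ≤ 5 / 12}

theorem measurableSet_bumpSet (j : Fin m) : MeasurableSet (bumpSet j) := by
  have h : Measurable fun x : unitInterval => (m : ℝ) * x - (j : ℕ) := by fun_prop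
  exact (measurableSet_le measurable_const h).inter (measurableSet_le h measurable_const)

theorem pairwise_disjoint_bumpSet :
    Pairwise (Function.onFun Disjoint (bumpSet (m := m))) := by
  intro j k hjk
  refine Set.disjoint_left.2 fun x hj hk => hjk (Fin.ext ?_)
  have h3 : ((k : ℕ) : ℝ) < (j : ℕ) + 1 := by linarith [hj.2, hk.1]
  have h4 : ((j : ℕ) : ℝ) < (k : ℕ) + 1 := by linarith [hj.1, hk.2]
  norm_cast at h3 h4
  lia

theorem volume_bumpSet (j : Fin m) :
    volume (bumpSet j) = ENNReal.ofReal ((3 * m : ℝ)⁻¹) := by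
  have hm : (0 : ℝ) < m := by
    have := j.pos
    positivity
  have hj : ((j : ℕ) : ℝ) + 1 ≤ m := by exact_mod_cast j.2
  have hj0 : (0 : ℝ) ≤ (j : ℕ) := Nat.cast_nonneg _
  have ha : ((j : ℕ) + 1 / 12) / (m : ℝ) ∈ unitInterval :=
    ⟨by positivity, (div_le_one hm).2 (by linarith)⟩
  have hb : ((j : ℕ) + 5 / 12) / (m : ℝ) ∈ unitInterval :=
    ⟨by positivity, (div_le_one hm).2 (by linarith)⟩
  have : bumpSet j = Set.Icc (⟨_, ha⟩ : unitInterval) ⟨_, hb⟩ := by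
    ext x
    rw [Set.mem_Icc, ← Subtype.coe_le_coe, ← Subtype.coe_le_coe]
    simp only [bumpSet, Set.mem_ofPred_eq]
    rw [div_le_iff₀ hm, le_div_iff₀ hm]
    constructor <;> rintro ⟨h1, h2⟩ <;> constructor <;> linarith
  rw [this, unitInterval.volume_Icc]
  congr 1
  field_simp
  ring

theorem le_abs_cubeDensity_sub_flipAt (hγ : 0 ≤ γ) (θ : Fin m → Bool) {j : Fin m}
    {x : unitInterval} (hx : x ∈ bumpSet j) :
    γ ≤ |cubeDensity m γ θ x - cubeDensity m γ (flipAt j θ) x| := by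
  have h := half_le_bump hx.1 hx.2
  rw [cubeDensity_sub_flipAt, abs_mul, abs_mul, abs_boolSign, mul_one,
    abs_of_nonneg (by positivity : 0 ≤ 2 * γ)]
  nlinarith [le_abs_self (bump (m * (x : ℝ) - (j : ℕ)))]

end cubeDensity

/-! ### The information contained in the output of a private mechanism -/

theorem Psi_nonneg (ε : ℝ) : 0 ≤ Psi ε := by unfold Psi; positivity

/-- A measure which is comparable to `μ` has a density with respect to `μ` that is bounded above
and below. -/
theorem exists_density_of_le {Y : Type*} [MeasurableSpace Y] {μ ν : Measure Y}
    [IsFiniteMeasure μ] {c C : ℝ} (hc : 0 ≤ c) (hcC : c ≤ C)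
    (h1 : ∀ S, MeasurableSet S → ENNReal.ofReal c * μ S ≤ ν S)
    (h2 : ∀ S, MeasurableSet S → ν S ≤ ENNReal.ofReal C * μ S) :
    ∃ u : Y → ℝ, Measurable u ∧ (∀ y, c ≤ u y) ∧ (∀ y, u y ≤ C) ∧
      ν = μ.withDensity fun y => ENNReal.ofReal (u y) := by
  have hν : IsFiniteMeasure ν :=
    ⟨(h2 _ MeasurableSet.univ).trans_lt
      (ENNReal.mul_lt_top ENNReal.ofReal_lt_top (measure_lt_top μ _))⟩
  have hac : ν ≪ μ := by
    refine Measure.AbsolutelyContinuous.mk fun S hS h0 => ?_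
    simpa [h0] using h2 S hS
  have hd := Measure.withDensity_rnDeriv_eq ν μ hac
  have hm := Measure.measurable_rnDeriv ν μ
  have hset : ∀ S, MeasurableSet S → ∫⁻ y in S, ν.rnDeriv μ y ∂μ = ν S := by
    intro S hS
    rw [← withDensity_apply _ hS, hd]
  have hl : ∀ᵐ y ∂μ, ENNReal.ofReal c ≤ ν.rnDeriv μ y := by
    refine ae_le_of_forall_setLIntegral_le_of_sigmaFinite measurable_const fun S hS _ => ?_
    rw [hset S hS, lintegral_const, Measure.restrict_apply_univ]
    exact h1 S hS
  have hu : ∀ᵐ y ∂μ, ν.rnDeriv μ y ≤ ENNReal.ofReal C := by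
    refine ae_le_of_forall_setLIntegral_le_of_sigmaFinite hm fun S hS _ => ?_
    rw [hset S hS, lintegral_const, Measure.restrict_apply_univ]
    exact h2 S hS
  -- The bounds on the derivative hold only almost everywhere; truncation to `[c, C]` makes them
  -- hold at every point.
  refine ⟨fun y => max c (min C (ν.rnDeriv μ y).toReal),
    measurable_const.max (measurable_const.min hm.ennreal_toReal),
    fun y => le_max_left _ _, fun y => max_le hcC (min_le_left _ _), ?_⟩
  conv_lhs => rw [← hd]
  refine withDensity_congr_ae ?_
  filter_upwards [hl, hu] with y hy1 hy2
  have hfin : ν.rnDeriv μ y ≠ ∞ := (hy2.trans_lt ENNReal.ofReal_lt_top).ne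
  have h3 : c ≤ (ν.rnDeriv μ y).toReal := (ENNReal.ofReal_le_iff_le_toReal hfin).1 hy1
  have h4 : (ν.rnDeriv μ y).toReal ≤ C := ENNReal.toReal_le_of_le_ofReal (hc.trans hcC) hy2
  rw [min_eq_right h4, max_eq_right h3, ENNReal.ofReal_toReal hfin]

/-- If the vector-valued function `g` has integral of norm at most `B * μ S` over all sets `S`,
then its norm is almost everywhere at most `B`. -/
theorem ae_sum_sq_le {Y ι : Type*} [Fintype ι] [MeasurableSpace Y] {μ : Measure Y}
    [IsFiniteMeasure μ] {g : ι → Y → ℝ} (hg : ∀ j, Integrable (g j) μ) {B : ℝ}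
    (h : ∀ a : ι → ℝ, ∀ S, MeasurableSet S →
      ∫ y in S, ∑ j, a j * g j y ∂μ ≤ B * √(∑ j, a j ^ 2) * μ.real S) :
    ∀ᵐ y ∂μ, ∑ j, g j y ^ 2 ≤ B ^ 2 := by
  have h1 : ∀ a : ι → ℝ, ∀ᵐ y ∂μ, ∑ j, a j * g j y ≤ B * √(∑ j, a j ^ 2) := by
    intro a
    refine ae_le_of_forall_setIntegral_le
      (integrable_finsetSum _ fun j _ => (hg j).const_mul _) (integrable_const _)
      fun S hS _ => ?_
    rw [setIntegral_const, smul_eq_mul, mul_comm]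
    exact h a S hS
  -- The exceptional null set depends on `a`. Restricting to a dense sequence leaves countably many
  -- null sets, and continuity in `a` recovers every vector, including the choice `a = g(y)` made
  -- below.
  have h2 : ∀ᵐ y ∂μ, ∀ k : ℕ, ∑ j, TopologicalSpace.denseSeq (ι → ℝ) k j * g j y
      ≤ B * √(∑ j, TopologicalSpace.denseSeq (ι → ℝ) k j ^ 2) :=
    ae_all_iff.2 fun k => h1 _
  filter_upwards [h2] with y hy
  have h3 : ∀ a : ι → ℝ, ∑ j, a j * g j y ≤ B * √(∑ j, a j ^ 2) := by
    have hcl : IsClosed {a : ι → ℝ | ∑ j, a j * g j y ≤ B * √(∑ j, a j ^ 2)} :=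
      isClosed_le (by fun_prop) (by fun_prop)
    intro a
    refine (hcl.closure_subset_iff.2 ?_) (TopologicalSpace.denseRange_denseSeq (ι → ℝ) a)
    rintro _ ⟨k, rfl⟩
    exact hy k
  have h4 := h3 fun j => g j y
  have h5 : ∑ j, g j y * g j y = ∑ j, g j y ^ 2 := Finset.sum_congr rfl fun j _ => (sq _).symm
  rw [h5] at h4
  have h0 : 0 ≤ ∑ j, g j y ^ 2 := Finset.sum_nonneg fun j _ => sq_nonneg _
  have h6 := Real.sq_sqrt h0
  set s := √(∑ j, g j y ^ 2)
  have hs : 0 ≤ s := Real.sqrt_nonneg _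
  rcases hs.eq_or_lt with hs0 | hs0
  · rw [← h6, ← hs0]
    simpa using sq_nonneg B
  · rw [← h6] at h4 ⊢
    have : s ≤ B := by nlinarith
    gcongr

/-! ### Contraction of perturbations by a private kernel -/

section kernel

variable {T X Z : Type*} [MeasurableSpace T] [MeasurableSpace X] [MeasurableSpace Z]

theorem integrable_of_abs_le {Y : Type*} [MeasurableSpace Y] {μ : Measure Y} [IsFiniteMeasure μ]
    {g : Y → ℝ} (hg : Measurable g) {C : ℝ} (hC : ∀ y, |g y| ≤ C) : Integrable g μ :=
  Integrable.of_bound hg.aestronglyMeasurable C (.of_forall hC)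

theorem sq_integral_mul_le {P : Measure X} [IsFiniteMeasure P] {f g : X → ℝ} (hf : Measurable f)
    (hg : Measurable g) {C D : ℝ} (hC : ∀ x, |f x| ≤ C) (hD : ∀ x, |g x| ≤ D) :
    (∫ x, f x * g x ∂P) ^ 2 ≤ (∫ x, f x ^ 2 ∂P) * ∫ x, g x ^ 2 ∂P := by
  have hC0 : ∀ x, |f x ^ 2| ≤ C ^ 2 := fun x => by
    rw [abs_pow]; exact pow_le_pow_left₀ (abs_nonneg _) (hC x) 2
  have hD0 : ∀ x, |g x ^ 2| ≤ D ^ 2 := fun x => by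
    rw [abs_pow]; exact pow_le_pow_left₀ (abs_nonneg _) (hD x) 2
  have hfg : ∀ x, |f x * g x| ≤ C * D := fun x => by
    rw [abs_mul]
    exact mul_le_mul (hC x) (hD x) (abs_nonneg _) ((abs_nonneg _).trans (hC x))
  have i1 := integrable_of_abs_le (μ := P) (hf.pow_const 2) hC0
  have i2 := integrable_of_abs_le (μ := P) (hg.pow_const 2) hD0
  have i3 : Integrable (fun x => f x * g x) P := integrable_of_abs_le (hf.mul hg) hfg
  have key : ∀ s : ℝ, 0 ≤ (∫ x, g x ^ 2 ∂P) * (s * s) + (-2 * ∫ x, f x * g x ∂P) * s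
      + ∫ x, f x ^ 2 ∂P := by
    intro s
    have h0 : 0 ≤ ∫ x, (f x - s * g x) ^ 2 ∂P := integral_nonneg fun x => sq_nonneg _
    have h1 : ∀ x, (f x - s * g x) ^ 2 = f x ^ 2 - 2 * s * (f x * g x) + s ^ 2 * g x ^ 2 :=
      fun x => by ring
    simp only [h1] at h0
    have i4 := i3.const_mul (2 * s)
    rw [integral_add (by exact i1.sub i4) (i2.const_mul _), integral_sub i1 i4,
      integral_const_mul, integral_const_mul] at h0
    linarith
  have := discrim_le_zero key
  rw [discrim] at this
  linarith

/-- Since `ψ` has mean zero, `k` may be replaced by `k - q`; Cauchy-Schwarz then leaves the variance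
of `k`, which privacy controls relative to `q ^ 2`. -/
theorem abs_integral_mul_le_of_ldp {P : Measure X} [IsProbabilityMeasure P] {ε : ℝ}
    {k ψ : X → ℝ} (hk : Measurable k) (hk0 : ∀ x, 0 ≤ k x) (hk1 : ∀ x, k x ≤ 1)
    (hldp : ∀ x x', k x ≤ Real.exp ε * k x')
    (hψ : Measurable ψ) {C : ℝ} (hC : ∀ x, |ψ x| ≤ C) (hψ0 : ∫ x, ψ x ∂P = 0) :
    |∫ x, ψ x * k x ∂P| ≤ √((∫ x, ψ x ^ 2 ∂P) * Psi ε) * ∫ x, k x ∂P := by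
  have hkabs : ∀ x, |k x| ≤ 1 := fun x => by rw [abs_of_nonneg (hk0 x)]; exact hk1 x
  have ik := integrable_of_abs_le (μ := P) hk hkabs
  have iψ := integrable_of_abs_le (μ := P) hψ hC
  set q := ∫ x, k x ∂P with hq
  have hq0 : 0 ≤ q := integral_nonneg hk0
  have hup : ∀ x, k x ≤ Real.exp ε * q := by
    intro x
    have := integral_mono (μ := P) (integrable_const (k x)) (ik.const_mul (Real.exp ε))
      fun x' => hldp x x'
    simpa [integral_const_mul] using this
  have hlow : ∀ x, Real.exp (-ε) * q ≤ k x := by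
    intro x
    have := integral_mono (μ := P) ik (integrable_const (Real.exp ε * k x)) fun x' => hldp x' x
    rw [integral_const, probReal_univ, one_smul] at this
    calc Real.exp (-ε) * q ≤ Real.exp (-ε) * (Real.exp ε * k x) :=
          mul_le_mul_of_nonneg_left this (Real.exp_pos _).le
      _ = k x := by rw [← mul_assoc, ← Real.exp_add]; simp
  -- The Bhatia-Davis inequality for values in `[e^{-ε} q, e^ε q]`: `(e^ε q - q)(q - e^{-ε} q) = Psi
  -- ε * q ^ 2`.
  have hvar : ∫ x, (k x - q) ^ 2 ∂P ≤ Psi ε * q ^ 2 := by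
    have h1 := variance_le_sub_mul_sub (μ := P) (X := k)
      (.of_forall fun x => ⟨hlow x, hup x⟩) hk.aemeasurable
    rw [variance_eq_integral hk.aemeasurable] at h1
    refine h1.trans_eq ?_
    rw [← hq, Psi]
    have : Real.exp (-ε) * Real.exp ε = 1 := by rw [← Real.exp_add]; simp
    linear_combination (q ^ 2 * (1 - Real.exp ε)) * this
  have hcs := sq_integral_mul_le (P := P) hψ (hk.sub_const q) hC
    (D := 1 + |q|) fun x => (abs_sub _ _).trans (by gcongr; exact hkabs x)
  have hcent : ∫ x, ψ x * (k x - q) ∂P = ∫ x, ψ x * k x ∂P := by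
    simp only [mul_sub]
    rw [integral_sub _ (iψ.mul_const q), integral_mul_const, hψ0]
    · simp
    · refine integrable_of_abs_le (C := C) (hψ.mul hk) fun x => ?_
      rw [abs_mul]
      exact (mul_le_of_le_one_right (abs_nonneg _) (hkabs x)).trans (hC x)
  rw [hcent] at hcs
  have hψ2 : 0 ≤ ∫ x, ψ x ^ 2 ∂P := integral_nonneg fun x => sq_nonneg _
  refine abs_le_of_sq_le_sq ?_ (by positivity)
  rw [mul_pow, Real.sq_sqrt (mul_nonneg hψ2 (Psi_nonneg ε)), mul_assoc]
  exact hcs.trans (mul_le_mul_of_nonneg_left hvar hψ2)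

theorem integral_sum_mul_sub {ι Y : Type*} [Fintype ι] [MeasurableSpace Y] {ν : Measure Y}
    {F G : ι → Y → ℝ} (hF : ∀ j, Integrable (F j) ν) (hG : ∀ j, Integrable (G j) ν)
    (a : ι → ℝ) :
    ∫ y, ∑ j, a j * (F j y - G j y) ∂ν = ∑ j, a j * (∫ y, F j y ∂ν - ∫ y, G j y ∂ν) := by
  have h : ∀ j, Integrable (fun y => a j * (F j y - G j y)) ν := fun j =>
    ((hF j).sub (hG j)).const_mul _
  rw [integral_finsetSum _ fun j _ => h j]
  exact Finset.sum_congr rfl fun j _ => by rw [integral_const_mul, integral_sub (hF j) (hG j)]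

/-- The law of a mechanism's output given the earlier transcript, for a sample drawn from `P`. -/
abbrev mixedKernel (K : Kernel (T × X) Z) (P : Measure X) : Kernel T Z :=
  K ∘ₖ (Kernel.id ×ₖ Kernel.const T P)

theorem measurable_section (K : Kernel (T × X) Z) [IsMarkovKernel K] {S : Set (T × Z)}
    (hS : MeasurableSet S) :
    Measurable fun p : T × X => K p (Prod.mk p.1 ⁻¹' S) := by
  have h : MeasurableSet {q : (T × X) × Z | (q.1.1, q.2) ∈ S} :=
    (measurable_fst.fst.prodMk measurable_snd) hS
  exact Kernel.measurable_kernel_prodMk_left h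

theorem compProd_mixedKernel_apply (μ : Measure T) [SFinite μ] (K : Kernel (T × X) Z)
    [IsMarkovKernel K] (P : Measure X) [SFinite P] {S : Set (T × Z)} (hS : MeasurableSet S) :
    (μ ⊗ₘ mixedKernel K P) S = ∫⁻ t, ∫⁻ x, K (t, x) (Prod.mk t ⁻¹' S) ∂P ∂μ := by
  rw [Measure.compProd_apply hS]
  refine lintegral_congr fun t => ?_
  have hSt : MeasurableSet (Prod.mk t ⁻¹' S) := measurable_prodMk_left hS
  rw [Kernel.comp_apply' _ _ _ hSt, Kernel.lintegral_id_prod (Kernel.measurable_coe _ hSt),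
    Kernel.const_apply]

variable {μ : Measure T} [IsProbabilityMeasure μ] {P : Measure X} [IsProbabilityMeasure P]
  {K : Kernel (T × X) Z} [IsMarkovKernel K]

theorem measurable_mul_section {f : X → ℝ} (hf : Measurable f) {S : Set (T × Z)}
    (hS : MeasurableSet S) :
    Measurable fun p : T × X => f p.2 * (K p).real (Prod.mk p.1 ⁻¹' S) :=
  (hf.comp measurable_snd).mul (measurable_section K hS).ennreal_toReal

theorem abs_mul_section_le {f : X → ℝ} {C : ℝ} (hC : ∀ x, |f x| ≤ C) (S : Set (T × Z))
    (p : T × X) : |f p.2 * (K p).real (Prod.mk p.1 ⁻¹' S)| ≤ C := by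
  rw [abs_mul, abs_of_nonneg (measureReal_nonneg (μ := K p))]
  exact (mul_le_of_le_one_right (abs_nonneg _) measureReal_le_one).trans (hC p.2)

theorem integrable_mul_section {f : X → ℝ} (hf : Measurable f) {C : ℝ} (hC : ∀ x, |f x| ≤ C)
    {S : Set (T × Z)} (hS : MeasurableSet S) :
    Integrable (fun p : T × X => f p.2 * (K p).real (Prod.mk p.1 ⁻¹' S)) (μ.prod P) :=
  integrable_of_abs_le (measurable_mul_section hf hS) (abs_mul_section_le hC S)

theorem integrable_section {S : Set (T × Z)} (hS : MeasurableSet S) :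
    Integrable (fun p : T × X => (K p).real (Prod.mk p.1 ⁻¹' S)) (μ.prod P) := by
  have := integrable_mul_section (μ := μ) (P := P) (K := K) (f := fun _ => 1)
    measurable_const (C := 1) (by simp) hS
  simpa using this

theorem real_compProd_mixedKernel_withDensity {f : X → ℝ} (hf : Measurable f)
    (hf0 : ∀ x, 0 ≤ f x) {S : Set (T × Z)} (hS : MeasurableSet S) :
    (μ ⊗ₘ mixedKernel K (P.withDensity fun x => ENNReal.ofReal (f x))).real S
      = ∫ p : T × X, f p.2 * (K p).real (Prod.mk p.1 ⁻¹' S) ∂(μ.prod P) := by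
  rw [measureReal_def, compProd_mixedKernel_apply _ _ _ hS,
    integral_eq_lintegral_of_nonneg_ae
      (.of_forall fun p => mul_nonneg (hf0 _) measureReal_nonneg)
      (measurable_mul_section hf hS).aestronglyMeasurable,
    lintegral_prod _ (measurable_mul_section hf hS).ennreal_ofReal.aemeasurable]
  congr 1
  refine lintegral_congr fun t => ?_
  have hk : Measurable fun x => K (t, x) (Prod.mk t ⁻¹' S) :=
    (measurable_section K hS).comp measurable_prodMk_left
  rw [lintegral_withDensity_eq_lintegral_mul _ hf.ennreal_ofReal hk]
  refine lintegral_congr fun x => ?_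
  simp only [Pi.mul_apply]
  rw [ENNReal.ofReal_mul (hf0 x), ofReal_measureReal]

theorem real_compProd_mixedKernel {S : Set (T × Z)} (hS : MeasurableSet S) :
    (μ ⊗ₘ mixedKernel K P).real S
      = ∫ p : T × X, (K p).real (Prod.mk p.1 ⁻¹' S) ∂(μ.prod P) := by
  have := real_compProd_mixedKernel_withDensity (μ := μ) (P := P) (K := K) (f := fun _ => 1)
    measurable_const (fun _ => zero_le_one) hS
  simpa using this

/-- The one-user bound is applied to the section of `S` at each transcript `t` and integrated.
Working with joint events in `T × Z` avoids conditional densities, so no regularity of the output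
space is needed. -/
theorem abs_integral_mul_section_le {ε : ℝ} (hK : IsLDP ε K) {ψ : X → ℝ} (hψ : Measurable ψ)
    {C : ℝ} (hC : ∀ x, |ψ x| ≤ C) (hψ0 : ∫ x, ψ x ∂P = 0) {S : Set (T × Z)}
    (hS : MeasurableSet S) :
    |∫ p : T × X, ψ p.2 * (K p).real (Prod.mk p.1 ⁻¹' S) ∂(μ.prod P)|
      ≤ √((∫ x, ψ x ^ 2 ∂P) * Psi ε) * (μ ⊗ₘ mixedKernel K P).real S := by
  have i1 := integrable_section (μ := μ) (P := P) (K := K) hS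
  rw [real_compProd_mixedKernel hS, integral_prod _ (integrable_mul_section hψ hC hS),
    integral_prod _ i1, ← integral_const_mul]
  refine (abs_integral_le_integral_abs).trans (integral_mono_of_nonneg
    (.of_forall fun _ => abs_nonneg _) (i1.integral_prod_left.const_mul _) (.of_forall fun t => ?_))
  refine abs_integral_mul_le_of_ldp
    (k := fun x => (K (t, x)).real (Prod.mk t ⁻¹' S))
    ((measurable_section K hS).comp measurable_prodMk_left).ennreal_toReal
    (fun _ => measureReal_nonneg) (fun _ => measureReal_le_one) (fun x x' => ?_) hψ hC hψ0
  have h := hK t x x' _ (measurable_prodMk_left (x := t) hS)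
  have h2 := ENNReal.toReal_mono
    (ENNReal.mul_ne_top ENNReal.ofReal_ne_top (measure_ne_top _ _)) h
  rwa [ENNReal.toReal_mul, ENNReal.toReal_ofReal (Real.exp_pos ε).le] at h2

/-- The densities of the output of a private mechanism under nearby distributions of the sample
are close, in the sense of a Bessel inequality. -/
theorem exists_output_densities {Θ ι : Type*} [Fintype ι] {ε D : ℝ} (hDpos : 0 ≤ D)
    (hK : IsLDP ε K)
    {f : Θ → X → ℝ} (hf : ∀ θ, Measurable (f θ)) (hf1 : ∀ θ x, 1 / 2 ≤ f θ x)
    (hf2 : ∀ θ x, f θ x ≤ 2) (hfint : ∀ θ, ∫ x, f θ x ∂P = 1) (nb : ι → Θ → Θ)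
    (hD : ∀ θ (a : ι → ℝ),
      ∫ x, (∑ j, a j * (f θ x - f (nb j θ) x)) ^ 2 ∂P ≤ D * ∑ j, a j ^ 2) :
    ∃ u : Θ → T × Z → ℝ, (∀ θ, Measurable (u θ)) ∧ (∀ θ y, 1 / 2 ≤ u θ y) ∧
      (∀ θ y, u θ y ≤ 2) ∧
      (∀ θ, μ ⊗ₘ mixedKernel K (P.withDensity fun x => ENNReal.ofReal (f θ x))
        = (μ ⊗ₘ mixedKernel K P).withDensity fun y => ENNReal.ofReal (u θ y)) ∧
      ∀ θ, ∀ᵐ y ∂(μ ⊗ₘ mixedKernel K P), ∑ j, (u θ y - u (nb j θ) y) ^ 2 ≤ D * Psi ε := by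
  have hf0 : ∀ θ x, 0 ≤ f θ x := fun θ x => by linarith [hf1 θ x]
  have hfabs : ∀ θ x, |f θ x| ≤ 2 := fun θ x => by rw [abs_of_nonneg (hf0 θ x)]; exact hf2 θ x
  have hprob : ∀ θ, IsProbabilityMeasure (P.withDensity fun x => ENNReal.ofReal (f θ x)) := by
    intro θ
    refine ⟨?_⟩
    rw [withDensity_apply _ MeasurableSet.univ, Measure.restrict_univ,
      ← ofReal_integral_eq_lintegral_ofReal (integrable_of_abs_le (hf θ) (hfabs θ))
        (.of_forall (hf0 θ)), hfint, ENNReal.ofReal_one]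
  have hreal := fun θ (S : Set (T × Z)) (hS : MeasurableSet S) =>
    real_compProd_mixedKernel_withDensity (μ := μ) (P := P) (K := K) (hf θ) (hf0 θ) hS
  have i1 := fun (S : Set (T × Z)) (hS : MeasurableSet S) =>
    integrable_section (μ := μ) (P := P) (K := K) hS
  have key : ∀ θ, ∃ u : T × Z → ℝ, Measurable u ∧ (∀ y, 1 / 2 ≤ u y) ∧ (∀ y, u y ≤ 2) ∧
      μ ⊗ₘ mixedKernel K (P.withDensity fun x => ENNReal.ofReal (f θ x))
        = (μ ⊗ₘ mixedKernel K P).withDensity fun y => ENNReal.ofReal (u y) := by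
    intro θ
    have := hprob θ
    refine exists_density_of_le (by norm_num) (by norm_num) (fun S hS => ?_) (fun S hS => ?_)
    · rw [← ofReal_measureReal (μ := μ ⊗ₘ mixedKernel K P),
        ← ofReal_measureReal (μ := μ ⊗ₘ mixedKernel K (P.withDensity _)),
        ← ENNReal.ofReal_mul (by norm_num)]
      refine ENNReal.ofReal_le_ofReal ?_
      rw [hreal θ S hS, real_compProd_mixedKernel hS, ← integral_const_mul]
      refine integral_mono ((i1 S hS).const_mul _) (integrable_mul_section (hf θ) (hfabs θ) hS) ?_
      exact fun p => mul_le_mul_of_nonneg_right (hf1 θ p.2) measureReal_nonneg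
    · rw [← ofReal_measureReal (μ := μ ⊗ₘ mixedKernel K P),
        ← ofReal_measureReal (μ := μ ⊗ₘ mixedKernel K (P.withDensity _)),
        ← ENNReal.ofReal_mul (by norm_num)]
      refine ENNReal.ofReal_le_ofReal ?_
      rw [hreal θ S hS, real_compProd_mixedKernel hS, ← integral_const_mul]
      refine integral_mono (integrable_mul_section (hf θ) (hfabs θ) hS) ((i1 S hS).const_mul _) ?_
      exact fun p => mul_le_mul_of_nonneg_right (hf2 θ p.2) measureReal_nonneg
  choose u hu hu1 hu2 hud using key
  refine ⟨u, hu, hu1, hu2, hud, fun θ => ?_⟩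
  have hu0 : ∀ θ y, |u θ y| ≤ 2 := fun θ y => by
    rw [abs_of_nonneg (by linarith [hu1 θ y])]
    exact hu2 θ y
  have iu : ∀ θ, Integrable (u θ) (μ ⊗ₘ mixedKernel K P) := fun θ =>
    integrable_of_abs_le (hu θ) (hu0 θ)
  have hset : ∀ θ S, MeasurableSet S → ∫ y in S, u θ y ∂(μ ⊗ₘ mixedKernel K P)
      = ∫ p : T × X, f θ p.2 * (K p).real (Prod.mk p.1 ⁻¹' S) ∂(μ.prod P) := by
    intro θ S hS
    rw [← hreal θ S hS, hud θ, measureReal_def, withDensity_apply _ hS,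
      integral_eq_lintegral_of_nonneg_ae (.of_forall fun y => by
        simpa using (show (0 : ℝ) ≤ u θ y by linarith [hu1 θ y])) (hu θ).aestronglyMeasurable]
  -- By duality it suffices to bound, for each fixed `a` and `S`, the integral over `S` of the
  -- combination of density differences; this integral is the effect on the event `S` of the
  -- perturbation `ψ = ∑ j, a j * (f θ - f (nb j θ))`.
  have hB := ae_sum_sq_le (μ := μ ⊗ₘ mixedKernel K P) (g := fun j y => u θ y - u (nb j θ) y)
    (fun j => (iu θ).sub (iu (nb j θ))) (B := √(D * Psi ε)) fun a S hS => ?_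
  · rwa [Real.sq_sqrt (mul_nonneg hDpos (Psi_nonneg ε))] at hB
  have hψm : Measurable fun x => ∑ j, a j * (f θ x - f (nb j θ) x) :=
    Finset.measurable_fun_sum _ fun j _ => ((hf θ).sub (hf (nb j θ))).const_mul _
  have hψC : ∀ x, |∑ j, a j * (f θ x - f (nb j θ) x)| ≤ ∑ j, |a j| * (2 + 2) := fun x =>
    (Finset.abs_sum_le_sum_abs _ _).trans (Finset.sum_le_sum fun j _ => by
      rw [abs_mul]
      exact mul_le_mul_of_nonneg_left
        ((abs_sub _ _).trans (add_le_add (hfabs _ _) (hfabs _ _))) (abs_nonneg _))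
  have iF : ∀ θ, Integrable (f θ) P := fun θ => integrable_of_abs_le (hf θ) (hfabs θ)
  have hψ0 : ∫ x, ∑ j, a j * (f θ x - f (nb j θ) x) ∂P = 0 := by
    rw [integral_sum_mul_sub (fun _ => iF θ) (fun j => iF (nb j θ))]
    simp [hfint]
  have hmain := abs_integral_mul_section_le (μ := μ) (P := P) hK hψm hψC hψ0 hS
  have heq : ∫ y in S, ∑ j, a j * (u θ y - u (nb j θ) y) ∂(μ ⊗ₘ mixedKernel K P)
      = ∫ p : T × X, (∑ j, a j * (f θ p.2 - f (nb j θ) p.2)) * (K p).real (Prod.mk p.1 ⁻¹' S)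
        ∂(μ.prod P) := by
    have h1 : ∀ p : T × X,
        (∑ j, a j * (f θ p.2 - f (nb j θ) p.2)) * (K p).real (Prod.mk p.1 ⁻¹' S)
          = ∑ j, a j * (f θ p.2 * (K p).real (Prod.mk p.1 ⁻¹' S)
            - f (nb j θ) p.2 * (K p).real (Prod.mk p.1 ⁻¹' S)) := by
      intro p
      rw [Finset.sum_mul]
      exact Finset.sum_congr rfl fun j _ => by ring
    have i2 : ∀ θ, Integrable (fun p : T × X => f θ p.2 * (K p).real (Prod.mk p.1 ⁻¹' S))
      (μ.prod P) := fun θ => integrable_mul_section (hf θ) (hfabs θ) hS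
    simp only [h1]
    rw [integral_sum_mul_sub (fun _ => i2 θ) (fun j => i2 (nb j θ)),
      integral_sum_mul_sub (fun _ => (iu θ).integrableOn) (fun j => (iu (nb j θ)).integrableOn)]
    simp only [hset _ S hS]
  rw [heq]
  refine (le_abs_self _).trans (hmain.trans (mul_le_mul_of_nonneg_right ?_ measureReal_nonneg))
  rw [← Real.sqrt_mul (mul_nonneg hDpos (Psi_nonneg ε))]
  refine Real.sqrt_le_sqrt ?_
  calc _ ≤ D * (∑ j, a j ^ 2) * Psi ε := mul_le_mul_of_nonneg_right (hD θ a) (Psi_nonneg ε)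
    _ = _ := by ring

end kernel

/-! ### The Hellinger affinities of the laws of the transcript -/

theorem withDensity_compProd {T Z : Type*} [MeasurableSpace T] [MeasurableSpace Z]
    {μ : Measure T} [SFinite μ] {κ : Kernel T Z} [IsSFiniteKernel κ] {l : T → ℝ≥0∞}
    (hl : Measurable l) :
    (μ.withDensity l) ⊗ₘ κ = (μ ⊗ₘ κ).withDensity fun p => l p.1 := by
  ext S hS
  rw [Measure.compProd_apply hS, withDensity_apply _ hS, ← lintegral_indicator hS,
    Measure.lintegral_compProd (by exact (hl.comp measurable_fst).indicator hS),
    lintegral_withDensity_eq_lintegral_mul _ hl (Kernel.measurable_kernel_prodMk_left hS)]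
  refine lintegral_congr fun t => ?_
  have h : ∀ z, S.indicator (fun p : T × Z => l p.1) (t, z)
      = (Prod.mk t ⁻¹' S).indicator (fun _ => l t) z := fun z => rfl
  simp only [h]
  rw [lintegral_indicator_const (measurable_prodMk_left hS)]
  rfl

/-- Weighting by `u` replaces `κ` by `κ'`, which leaves the first marginal `μ` unchanged. -/
theorem integral_fst_mul_density {T Z : Type*} [MeasurableSpace T] [MeasurableSpace Z]
    {μ : Measure T} [SFinite μ] {κ κ' : Kernel T Z} [IsMarkovKernel κ'] {u : T × Z → ℝ}
    (hu : Measurable u) (hu0 : ∀ y, 0 ≤ u y)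
    (h : μ ⊗ₘ κ' = (μ ⊗ₘ κ).withDensity fun y => ENNReal.ofReal (u y))
    {G : T → ℝ} (hG : Measurable G) :
    ∫ y, G y.1 * u y ∂(μ ⊗ₘ κ) = ∫ t, G t ∂μ := by
  have h1 : ∫ t, G t ∂μ = ∫ y, G y.1 ∂(μ ⊗ₘ κ') := by
    conv_lhs => rw [← Measure.fst_compProd μ κ', Measure.fst]
    exact integral_map measurable_fst.aemeasurable hG.aestronglyMeasurable
  rw [h1, h, integral_withDensity_eq_integral_toReal_smul hu.ennreal_ofReal
    (.of_forall fun _ => ENNReal.ofReal_lt_top)]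
  refine integral_congr_ae (.of_forall fun y => ?_)
  simp only [ENNReal.toReal_ofReal (hu0 y), smul_eq_mul, mul_comm]

theorem integral_eq_one_of_withDensity {Y : Type*} [MeasurableSpace Y] {μ : Measure Y}
    {l : Y → ℝ} (hl : Measurable l) (hl0 : ∀ y, 0 ≤ l y)
    (h : IsProbabilityMeasure (μ.withDensity fun y => ENNReal.ofReal (l y))) :
    ∫ y, l y ∂μ = 1 := by
  have h1 := h.measure_univ
  rw [withDensity_apply _ MeasurableSet.univ, Measure.restrict_univ] at h1
  rw [integral_eq_lintegral_of_nonneg_ae (.of_forall hl0) hl.aestronglyMeasurable, h1,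
    ENNReal.toReal_one]

/-- With `a = √u` and `b = √v`, the arithmetic mean minus the geometric mean is `(a-b)²/2`, while
`(u-v)²/4 = (a-b)²(a+b)²/4`, and `(a+b)² ≥ 2`. -/
theorem sub_sq_le_sqrt_mul {u v : ℝ} (hu : 1 / 2 ≤ u) (hv : 1 / 2 ≤ v) :
    (u + v) / 2 - (u - v) ^ 2 / 4 ≤ √(u * v) := by
  rw [Real.sqrt_mul (by linarith)]
  have h1 := Real.sq_sqrt (show 0 ≤ u by linarith)
  have h2 := Real.sq_sqrt (show 0 ≤ v by linarith)
  have h3 := Real.sqrt_nonneg u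
  have h4 := Real.sqrt_nonneg v
  generalize √u = a at *
  generalize √v = b at *
  subst h1 h2
  have hab : 1 / 2 ≤ a * b := abs_le_of_sq_le_sq' (by nlinarith) (by positivity) |>.2
  nlinarith [mul_nonneg (sq_nonneg (a - b)) (show 0 ≤ (a + b) ^ 2 - 2 by nlinarith)]

/-- One-step loss of affinity. The main term `√(l k) (u+v)/2` integrates to the old affinity, and in
the error term `√(l k)` is replaced by the larger `(l+k)/2`, so that each part becomes an
expectation under one of the two laws. -/
theorem integral_sqrt_mul_ge {T Z : Type*} [MeasurableSpace T] [MeasurableSpace Z]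
    {μ : Measure T} [IsProbabilityMeasure μ] {κ κ₁ κ₂ : Kernel T Z} [IsMarkovKernel κ]
    [IsMarkovKernel κ₁] [IsMarkovKernel κ₂] {u v : T × Z → ℝ}
    (hu : Measurable u) (hu1 : ∀ y, 1 / 2 ≤ u y) (hu2 : ∀ y, u y ≤ 2)
    (hv : Measurable v) (hv1 : ∀ y, 1 / 2 ≤ v y) (hv2 : ∀ y, v y ≤ 2)
    (h1 : μ ⊗ₘ κ₁ = (μ ⊗ₘ κ).withDensity fun y => ENNReal.ofReal (u y))
    (h2 : μ ⊗ₘ κ₂ = (μ ⊗ₘ κ).withDensity fun y => ENNReal.ofReal (v y))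
    {l k : T → ℝ} (hl : Measurable l) (hk : Measurable k) (hl0 : ∀ t, 0 ≤ l t)
    (hk0 : ∀ t, 0 ≤ k t) {C : ℝ} (hlC : ∀ t, l t ≤ C) (hkC : ∀ t, k t ≤ C) :
    ∫ t, √(l t * k t) ∂μ
        - (∫ y, l y.1 * (u y - v y) ^ 2 ∂(μ ⊗ₘ κ) + ∫ y, k y.1 * (u y - v y) ^ 2 ∂(μ ⊗ₘ κ)) / 8
      ≤ ∫ y, √((l y.1 * u y) * (k y.1 * v y)) ∂(μ ⊗ₘ κ) := by
  have hC0 : ∀ t : T, 0 ≤ C := fun t => (hl0 t).trans (hlC t)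
  have hs : ∀ t, √(l t * k t) ≤ C := fun t => by
    rw [Real.sqrt_le_left (hC0 t), sq]
    exact mul_le_mul (hlC t) (hkC t) (hk0 t) (hC0 t)
  have hsm : Measurable fun t => √(l t * k t) := (hl.mul hk).sqrt
  have isu : ∀ {w : T × Z → ℝ}, Measurable w → (∀ y, 1 / 2 ≤ w y) → (∀ y, w y ≤ 2) →
      Integrable (fun y => √(l y.1 * k y.1) * w y) (μ ⊗ₘ κ) := fun {w} hw hw1 hw2 =>
    integrable_of_abs_le (C := C * 2) ((hsm.comp measurable_fst).mul hw) fun y => by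
      have : 0 ≤ w y := by linarith [hw1 y]
      rw [abs_of_nonneg (by positivity)]
      exact mul_le_mul (hs _) (hw2 y) this (hC0 y.1)
  have hd : ∀ y, (u y - v y) ^ 2 ≤ 4 := fun y => by
    nlinarith [hu1 y, hu2 y, hv1 y, hv2 y]
  have ilu : ∀ {w : T → ℝ}, Measurable w → (∀ y, 0 ≤ w y) → (∀ y, w y ≤ C) →
      Integrable (fun y => w y.1 * (u y - v y) ^ 2) (μ ⊗ₘ κ) := fun {w} hw hw1 hw2 =>
    integrable_of_abs_le (C := C * 4)
      ((hw.comp measurable_fst).mul ((hu.sub hv).pow_const 2)) fun y => by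
      have := hw1 y.1
      rw [abs_of_nonneg (by positivity)]
      exact mul_le_mul (hw2 _) (hd y) (sq_nonneg _) (hC0 y.1)
  have i1 := (isu hu hu1 hu2).add (isu hv hv1 hv2) |>.div_const 2
  have i2 := (ilu hl hl0 hlC).add (ilu hk hk0 hkC) |>.div_const 8
  have i3 : Integrable (fun y => √((l y.1 * u y) * (k y.1 * v y))) (μ ⊗ₘ κ) := by
    refine integrable_of_abs_le (C := C * 2) (((hl.comp measurable_fst).mul hu).mul
      ((hk.comp measurable_fst).mul hv)).sqrt fun y => ?_
    have := hu1 y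
    have := hv1 y
    have := hC0 y.1
    rw [abs_of_nonneg (Real.sqrt_nonneg _), Real.sqrt_le_left (by positivity), sq]
    exact mul_le_mul (mul_le_mul (hlC _) (hu2 _) (by linarith) this)
      (mul_le_mul (hkC _) (hv2 _) (by linarith) this)
      (mul_nonneg (hk0 _) (by linarith)) (by positivity)
  have h3 := integral_fst_mul_density hu (fun y => by linarith [hu1 y]) h1 hsm
  have h4 := integral_fst_mul_density hv (fun y => by linarith [hv1 y]) h2 hsm
  have h5 := integral_mono (i1.sub i2) i3 fun y => by
    have hle := sub_sq_le_sqrt_mul (hu1 y) (hv1 y)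
    have hl1 := hl0 y.1
    have hk1 := hk0 y.1
    have hmean : √(l y.1 * k y.1) ≤ (l y.1 + k y.1) / 2 := by
      rw [Real.sqrt_le_left (by positivity)]
      nlinarith [sq_nonneg (l y.1 - k y.1)]
    have heq : √((l y.1 * u y) * (k y.1 * v y)) = √(l y.1 * k y.1) * √(u y * v y) := by
      rw [← Real.sqrt_mul (by positivity)]
      congr 1
      ring
    simp only [Pi.sub_apply, Pi.add_apply]
    rw [heq]
    have h6 := mul_le_mul_of_nonneg_left hle (Real.sqrt_nonneg (l y.1 * k y.1))
    have h7 := mul_le_mul_of_nonneg_right hmean (sq_nonneg (u y - v y))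
    linarith
  rw [integral_sub' i1 i2, integral_div, integral_div] at h5
  simp only [Pi.add_apply] at h5
  rw [integral_add (isu hu hu1 hu2) (isu hv hv1 hv2), integral_add (ilu hl hl0 hlC)
    (ilu hk hk0 hkC), h3, h4] at h5
  linarith

/-- The transcript has bounded likelihood ratios with respect to its law under `P`, and neighbours
in the cube have large Hellinger affinity on average. -/
theorem exists_likelihoods {X : Type} [MeasurableSpace X] {ε : ℝ} (M : Protocol.{u} X ε)
    {P : Measure X} [IsProbabilityMeasure P] {m : ℕ} {D : ℝ} (hDpos : 0 ≤ D)
    {f : (Fin m → Bool) → X → ℝ} (hf : ∀ θ, Measurable (f θ)) (hf1 : ∀ θ x, 1 / 2 ≤ f θ x)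
    (hf2 : ∀ θ x, f θ x ≤ 2)
    [hprob : ∀ θ, IsProbabilityMeasure (P.withDensity fun x => ENNReal.ofReal (f θ x))]
    (hfint : ∀ θ, ∫ x, f θ x ∂P = 1)
    (hD : ∀ θ (a : Fin m → ℝ),
      ∫ x, (∑ j, a j * (f θ x - f (flipAt j θ) x)) ^ 2 ∂P ≤ D * ∑ j, a j ^ 2) (n : ℕ) :
    ∃ l : (Fin m → Bool) → Transcript M.Z n → ℝ, (∀ θ, Measurable (l θ)) ∧
      (∀ θ t, 0 ≤ l θ t) ∧ (∀ θ t, l θ t ≤ 2 ^ n) ∧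
      (∀ θ, M.law (P.withDensity fun x => ENNReal.ofReal (f θ x)) n
        = (M.law P n).withDensity fun t => ENNReal.ofReal (l θ t)) ∧
      (2 : ℝ) ^ m * m - n * (2 ^ m * (D * Psi ε) / 4)
        ≤ ∑ θ, ∑ j, ∫ t, √(l θ t * l (flipAt j θ) t) ∂(M.law P n) := by
  induction n with
  | zero =>
    refine ⟨fun _ _ => 1, fun _ => measurable_const, by simp, by simp, fun θ => ?_, ?_⟩
    · simp [Protocol.law]
    · have := M.isProbabilityMeasure_law P 0
      simp
  | succ n ih =>
    obtain ⟨l, hl, hl0, hl2, hlaw, hsum⟩ := ih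
    have hμ := M.isProbabilityMeasure_law P n
    obtain ⟨u, hu, hu1, hu2, hud, hue⟩ := exists_output_densities (μ := M.law P n) (P := P)
      hDpos (M.ldp n) hf hf1 hf2 hfint flipAt hD
    set ν : Measure (Transcript M.Z n × M.Z n) := M.law P n ⊗ₘ mixedKernel (M.K n) P with hν
    have hone : ∀ θ, ∫ t, l θ t ∂(M.law P n) = 1 := fun θ =>
      integral_eq_one_of_withDensity (hl θ) (hl0 θ)
        (hlaw θ ▸ M.isProbabilityMeasure_law _ n)
    have hfst : ∀ {g : Transcript M.Z n → ℝ}, Measurable g →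
        ∫ y, g y.1 ∂ν = ∫ t, g t ∂(M.law P n) := by
      intro g hg
      conv_rhs => rw [← Measure.fst_compProd (M.law P n) (mixedKernel (M.K n) P), Measure.fst]
      exact (integral_map measurable_fst.aemeasurable hg.aestronglyMeasurable).symm
    refine ⟨fun θ y => l θ y.1 * u θ y, fun θ => ((hl θ).comp measurable_fst).mul (hu θ),
      fun θ y => mul_nonneg (hl0 _ _) (by linarith [hu1 θ y]), fun θ y => ?_, fun θ => ?_, ?_⟩
    · rw [pow_succ]
      exact mul_le_mul (hl2 _ _) (hu2 _ _) (by linarith [hu1 θ y]) (by positivity)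
    · change (M.law (P.withDensity fun x => ENNReal.ofReal (f θ x)) n) ⊗ₘ mixedKernel (M.K n)
        (P.withDensity fun x => ENNReal.ofReal (f θ x)) = ν.withDensity _
      rw [hlaw θ, withDensity_compProd (hl θ).ennreal_ofReal, hud θ]
      refine (withDensity_mul ν (hu θ).ennreal_ofReal
        ((hl θ).ennreal_ofReal.comp measurable_fst)).symm.trans ?_
      congr 1
      ext y
      rw [ENNReal.ofReal_mul (hl0 _ _), mul_comm]
      rfl
    · change _ ≤ ∑ θ, ∑ j, ∫ y : Transcript M.Z n × M.Z n,
        √((l θ y.1 * u θ y) * (l (flipAt j θ) y.1 * u (flipAt j θ) y)) ∂ν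
      -- The weight `l θ` does not depend on `j`, so for fixed `θ` the Bessel inequality bounds the
      -- sum over `j`, and `l θ` has integral one.
      set E : (Fin m → Bool) → Fin m → ℝ := fun θ j =>
        ∫ y, l θ y.1 * (u θ y - u (flipAt j θ) y) ^ 2 ∂ν with hE
      have hstep : ∀ θ j, ∫ t, √(l θ t * l (flipAt j θ) t) ∂(M.law P n)
          - (E θ j + E (flipAt j θ) j) / 8
          ≤ ∫ y, √((l θ y.1 * u θ y) * (l (flipAt j θ) y.1 * u (flipAt j θ) y)) ∂ν := by
        intro θ j
        have h := integral_sqrt_mul_ge (hu θ) (hu1 θ) (hu2 θ) (hu _) (hu1 _) (hu2 _) (hud θ)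
          (hud (flipAt j θ)) (hl θ) (hl (flipAt j θ)) (hl0 _) (hl0 _) (hl2 _) (hl2 _)
        have h2 : E (flipAt j θ) j
            = ∫ y, l (flipAt j θ) y.1 * (u θ y - u (flipAt j θ) y) ^ 2 ∂ν := by
          simp only [hE, flipAt_involutive j θ]
          simp only [sub_sq_comm]
        rw [h2]
        exact h
      have hEsum : ∀ θ, ∑ j, E θ j ≤ D * Psi ε := by
        intro θ
        have hint : ∀ j, Integrable (fun y => l θ y.1 * (u θ y - u (flipAt j θ) y) ^ 2) ν :=
          fun j => integrable_of_abs_le (C := 2 ^ n * 4)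
            (((hl θ).comp measurable_fst).mul (((hu _).sub (hu _)).pow_const 2)) fun y => by
            have := hl0 θ y.1
            rw [abs_of_nonneg (by positivity)]
            refine mul_le_mul (hl2 _ _) ?_ (sq_nonneg _) (by positivity)
            nlinarith [hu1 θ y, hu2 θ y, hu1 (flipAt j θ) y, hu2 (flipAt j θ) y]
        have hl1 : Integrable (fun y => l θ y.1 * (D * Psi ε)) ν :=
          (integrable_of_abs_le (C := 2 ^ n) ((hl θ).comp measurable_fst) fun y => by
            rw [Function.comp, abs_of_nonneg (hl0 θ y.1)]
            exact hl2 _ _).mul_const _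
        calc ∑ j, E θ j = ∫ y, ∑ j, l θ y.1 * (u θ y - u (flipAt j θ) y) ^ 2 ∂ν :=
              (integral_finsetSum _ fun j _ => hint j).symm
          _ ≤ ∫ y, l θ y.1 * (D * Psi ε) ∂ν := by
              refine integral_mono_ae (integrable_finsetSum _ fun j _ => hint j) hl1 ?_
              filter_upwards [hue θ] with y hy
              rw [← Finset.mul_sum]
              exact mul_le_mul_of_nonneg_left hy (hl0 _ _)
          _ = D * Psi ε := by
              rw [integral_mul_const, hfst (hl θ), hone, one_mul]
      have htot : ∑ θ, ∑ j, (E θ j + E (flipAt j θ) j) / 8 ≤ 2 ^ m * (D * Psi ε) / 4 := by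
        -- The terms weighted by the neighbour's likelihood are reindexed by the involution `flipAt
        -- j`, for each `j` separately.
        have h1 : ∑ θ, ∑ j, E (flipAt j θ) j = ∑ θ, ∑ j, E θ j := by
          exact Finset.sum_comm.trans ((Finset.sum_congr rfl fun j _ =>
            sum_flipAt j fun θ => E θ j).trans Finset.sum_comm)
        have h2 : ∑ θ : Fin m → Bool, ∑ j, E θ j ≤ 2 ^ m * (D * Psi ε) := by
          refine (Finset.sum_le_sum fun θ _ => hEsum θ).trans_eq ?_
          simp
        simp only [← Finset.sum_div, Finset.sum_add_distrib, h1]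
        linarith
      have hall := Finset.sum_le_sum (s := Finset.univ) fun θ _ =>
        Finset.sum_le_sum (s := Finset.univ) fun j _ => hstep θ j
      simp only [Finset.sum_sub_distrib] at hall
      push_cast
      linarith

/-! ### The reduction to the testing of neighbours in the cube -/

/-- A linear substitute for Le Cam's inequality, so that it can be averaged over pairs. A
coefficient `c` in place of `5/8` works when `c(1+c) ≥ 1`, and `5/8` gives `65/64`; an average
affinity of `3/4` then leaves an overlap of `1/4`. -/
theorem two_mul_sqrt_mul_sub_le_min {a b : ℝ} (ha : 0 ≤ a) (hb : 0 ≤ b) :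
    2 * √(a * b) - 5 / 8 * (a + b) ≤ min a b := by
  rw [Real.sqrt_mul ha]
  have h1 := Real.sq_sqrt ha
  have h2 := Real.sq_sqrt hb
  generalize √a = s at *
  generalize √b = t at *
  subst h1 h2
  refine le_min ?_ ?_
  · nlinarith [sq_nonneg (13 * s - 8 * t)]
  · nlinarith [sq_nonneg (13 * t - 8 * s)]

theorem rpow_half_le_add {h a b g γ : ℝ} (hh : 0 ≤ h) (hγ : 0 ≤ γ) (hab : γ ≤ |a - b|) :
    (γ / 2) ^ h ≤ |a - g| ^ h + |b - g| ^ h := by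
  have h1 : γ ≤ |a - g| + |b - g| := hab.trans (by
    rw [abs_sub_comm b g]
    exact abs_sub_le a g b)
  rcases le_total (γ / 2) |a - g| with h2 | h2
  · have := Real.rpow_le_rpow (by positivity) h2 hh
    have := Real.rpow_nonneg (abs_nonneg (b - g)) h
    linarith
  · have := Real.rpow_le_rpow (by positivity) (show γ / 2 ≤ |b - g| by linarith) hh
    have := Real.rpow_nonneg (abs_nonneg (a - g)) h
    linarith

theorem measurable_loss {T : Type*} [MeasurableSpace T] {h : ℝ} {f : unitInterval → ℝ}
    (hf : Measurable f) {fhat : T → unitInterval → ℝ}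
    (hfhat : Measurable (Function.uncurry fhat)) :
    Measurable fun p : T × unitInterval => ENNReal.ofReal (|f p.2 - fhat p.1 p.2| ^ h) := by
  have h1 : Measurable fun p : T × unitInterval => f p.2 - fhat p.1 p.2 :=
    (hf.comp measurable_snd).sub hfhat
  exact (h1.abs.pow_const h).ennreal_ofReal

theorem le_setLIntegral_loss_add {m : ℕ} {γ h : ℝ} (hγ : 0 ≤ γ) (hh : 0 ≤ h)
    (θ : Fin m → Bool) (j : Fin m) {g : unitInterval → ℝ} (hg : Measurable g) :
    ENNReal.ofReal ((γ / 2) ^ h * (3 * m : ℝ)⁻¹)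
      ≤ (∫⁻ x in bumpSet j, ENNReal.ofReal (|cubeDensity m γ θ x - g x| ^ h))
        + ∫⁻ x in bumpSet j, ENNReal.ofReal (|cubeDensity m γ (flipAt j θ) x - g x| ^ h) := by
  have h1 : Measurable fun x => ENNReal.ofReal (|cubeDensity m γ θ x - g x| ^ h) :=
    (((continuous_cubeDensity θ).measurable.sub hg).abs.pow_const h).ennreal_ofReal
  rw [← lintegral_add_left h1, ENNReal.ofReal_mul (by positivity), ← volume_bumpSet j,
    ← setLIntegral_const]
  refine setLIntegral_mono' (measurableSet_bumpSet j) fun x hx => ?_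
  rw [← ENNReal.ofReal_add (by positivity) (by positivity)]
  exact ENNReal.ofReal_le_ofReal
    (rpow_half_le_add hh hγ (le_abs_cubeDensity_sub_flipAt hγ θ hx))

theorem sum_setLIntegral_bumpSet_le {m : ℕ} (F : unitInterval → ℝ≥0∞) :
    ∑ j : Fin m, ∫⁻ x in bumpSet j, F x ≤ ∫⁻ x, F x := by
  rw [← tsum_fintype (L := .unconditional _),
    ← lintegral_iUnion measurableSet_bumpSet pairwise_disjoint_bumpSet]
  exact setLIntegral_le_lintegral _ _

/-- Assouad's reduction: the risk dominates the sum of the losses on the disjoint sets `bumpSet j`,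
and for each `j` the losses at `θ` and `flipAt j θ` cannot both be small where the two likelihoods
overlap. The condition `γ ≤ 1/2` keeps the densities within `[1/2, 2]`. -/
theorem le_minimaxRisk {m n : ℕ} {β L h ε γ : ℝ} (hm : 1 ≤ m) (hh : 0 ≤ h) (hγ : 0 ≤ γ)
    (hγ2 : γ ≤ 1 / 2) (hmem : ∀ θ, cubeDensity m γ θ ∈ HolderDensities β L)
    (hn : n * (4 * γ ^ 2 * (m : ℝ)⁻¹ * Psi ε) ≤ m) :
    ENNReal.ofReal ((γ / 2) ^ h / 24) ≤ minimaxRisk.{u} n β L h ε := by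
  refine le_iInf fun M => le_iInf fun fhat => le_iInf fun hfhat => ?_
  have hm0 : (0 : ℝ) < m := by exact_mod_cast hm
  have hf : ∀ θ, Measurable (cubeDensity m γ θ) := fun θ => (continuous_cubeDensity θ).measurable
  have hbd := fun θ x => abs_le.1 (abs_cubeDensity_sub_one_le hγ (m := m) θ x)
  have hprob : ∀ θ, IsProbabilityMeasure ((volume : Measure unitInterval).withDensity
      fun x => ENNReal.ofReal (cubeDensity m γ θ x)) := by
    intro θ
    refine ⟨?_⟩
    rw [withDensity_apply _ MeasurableSet.univ, Measure.restrict_univ,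
      ← ofReal_integral_eq_lintegral_ofReal (integrable_of_continuous (continuous_cubeDensity θ))
        (.of_forall (hmem θ).1), integral_cubeDensity, ENNReal.ofReal_one]
  obtain ⟨l, hl, hl0, hl2, hlaw, hsum⟩ := exists_likelihoods M (P := volume)
    (D := 4 * γ ^ 2 * (m : ℝ)⁻¹) (by positivity) hf (fun θ x => by linarith [(hbd θ x).1])
    (fun θ x => by linarith [(hbd θ x).2]) integral_cubeDensity
    integral_sq_sum_cubeDensity_sub_flipAt_le n
  have hμ := M.isProbabilityMeasure_law volume n
  set μ := M.law volume n
  have hone : ∀ θ, ∫ t, l θ t ∂μ = 1 := fun θ =>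
    integral_eq_one_of_withDensity (hl θ) (hl0 θ) (hlaw θ ▸ M.isProbabilityMeasure_law _ n)
  have il : ∀ θ, Integrable (l θ) μ := fun θ => integrable_of_abs_le (C := 2 ^ n) (hl θ) fun t => by
    rw [abs_of_nonneg (hl0 θ t)]
    exact hl2 θ t
  have imin : ∀ θ j, Integrable (fun t => min (l θ t) (l (flipAt j θ) t)) μ := fun θ j =>
    (il θ).inf (il (flipAt j θ))
  -- the overlap of neighbours
  have hmin : ∀ θ j, 2 * (∫ t, √(l θ t * l (flipAt j θ) t) ∂μ) - 5 / 4
      ≤ ∫ t, min (l θ t) (l (flipAt j θ) t) ∂μ := by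
    intro θ j
    have is : Integrable (fun t => √(l θ t * l (flipAt j θ) t)) μ := by
      refine integrable_of_abs_le (C := 2 ^ n) ((hl θ).mul (hl _)).sqrt fun t => ?_
      rw [abs_of_nonneg (Real.sqrt_nonneg _), Real.sqrt_le_left (by positivity), sq]
      exact mul_le_mul (hl2 _ _) (hl2 _ _) (hl0 _ _) (by positivity)
    have ia : Integrable (fun t => l θ t + l (flipAt j θ) t) μ := (il θ).add (il _)
    have h1 := integral_mono ((is.const_mul 2).sub (ia.const_mul (5 / 8))) (imin θ j) fun t =>
      two_mul_sqrt_mul_sub_le_min (hl0 θ t) (hl0 _ t)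
    rw [integral_sub' (is.const_mul 2) (ia.const_mul (5 / 8)), integral_const_mul,
      integral_const_mul, integral_add (il θ) (il _), hone, hone] at h1
    linarith
  -- By `hn` the affinities average at least `1 - 1/4`, and `2 * (3/4) - 5/4 = 1/4`.
  have hoverlap : (2 : ℝ) ^ m * m / 4
      ≤ ∑ θ, ∑ j, ∫ t, min (l θ t) (l (flipAt j θ) t) ∂μ := by
    have h1 := Finset.sum_le_sum (s := Finset.univ) fun θ _ =>
      Finset.sum_le_sum (s := Finset.univ) fun j _ => hmin θ j
    simp only [Finset.sum_sub_distrib, ← Finset.mul_sum] at h1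
    simp only [Finset.sum_const, Finset.card_univ, Fintype.card_pi, Fintype.card_bool,
      Finset.prod_const, Fintype.card_fin, nsmul_eq_mul] at h1
    push_cast at h1
    have h2 := mul_le_mul_of_nonneg_left hn (show (0 : ℝ) ≤ 2 ^ m by positivity)
    linarith
  -- the part of the risk that is due to a coordinate
  let ℓ : Fin m → (Fin m → Bool) → Transcript M.Z n → ℝ≥0∞ := fun j θ z =>
    ∫⁻ x in bumpSet j, ENNReal.ofReal (|cubeDensity m γ θ x - fhat z x| ^ h)
  have hℓm : ∀ j θ, Measurable (ℓ j θ) := fun j θ =>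
    (measurable_loss (hf θ) hfhat).lintegral_prod_right'
  set risk : (Fin m → Bool) → ℝ≥0∞ := fun θ =>
    ∫⁻ z, lossPow h (cubeDensity m γ θ) (fhat z) ∂(M.law (densityMeasure (cubeDensity m γ θ)) n)
  set a : (Fin m → Bool) → Fin m → ℝ≥0∞ := fun θ j =>
    ∫⁻ z, ENNReal.ofReal (l θ z) * ℓ j θ z ∂μ with ha
  have ham : ∀ j θ, Measurable fun z => ENNReal.ofReal (l θ z) * ℓ j θ z := fun j θ =>
    (hl θ).ennreal_ofReal.mul (hℓm j θ)
  have hrisk : ∀ θ, ∑ j, a θ j ≤ risk θ := by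
    intro θ
    have hlm : Measurable fun z => lossPow h (cubeDensity m γ θ) (fhat z) :=
      (measurable_loss (hf θ) hfhat).lintegral_prod_right'
    have h1 : risk θ = ∫⁻ z, ENNReal.ofReal (l θ z) * lossPow h (cubeDensity m γ θ) (fhat z) ∂μ := by
      simp only [risk, densityMeasure]
      rw [hlaw θ, lintegral_withDensity_eq_lintegral_mul _ (hl θ).ennreal_ofReal hlm]
      rfl
    simp only [h1, ha]
    rw [← lintegral_finsetSum _ fun j _ => ham j θ]
    refine lintegral_mono fun z => ?_
    rw [← Finset.mul_sum]
    exact mul_le_mul_right (sum_setLIntegral_bumpSet_le _) _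
  set w := ENNReal.ofReal ((γ / 2) ^ h * (3 * m : ℝ)⁻¹) with hw
  have hpair : ∀ θ j, w * ENNReal.ofReal (∫ t, min (l θ t) (l (flipAt j θ) t) ∂μ)
      ≤ a θ j + a (flipAt j θ) j := by
    intro θ j
    rw [ofReal_integral_eq_lintegral_ofReal (imin θ j)
      (.of_forall fun t => le_min (hl0 θ t) (hl0 _ t)),
      ← lintegral_const_mul _ ((hl θ).min (hl _)).ennreal_ofReal]
    simp only [ha]
    rw [← lintegral_add_left (ham j θ)]
    refine lintegral_mono fun z => ?_
    calc w * ENNReal.ofReal (min (l θ z) (l (flipAt j θ) z))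
        ≤ (ℓ j θ z + ℓ j (flipAt j θ) z) * ENNReal.ofReal (min (l θ z) (l (flipAt j θ) z)) := by
          gcongr
          exact le_setLIntegral_loss_add hγ hh θ j
            (hfhat.comp (measurable_prodMk_left (x := z)))
      _ ≤ ENNReal.ofReal (l θ z) * ℓ j θ z
            + ENNReal.ofReal (l (flipAt j θ) z) * ℓ j (flipAt j θ) z := by
          rw [add_mul, mul_comm (ℓ j θ z), mul_comm (ℓ j (flipAt j θ) z)]
          gcongr
          · exact min_le_left _ _
          · exact min_le_right _ _
  -- averaging over the cube
  set s := ⨆ f ∈ HolderDensities β L, ∫⁻ z, lossPow h f (fhat z) ∂(M.law (densityMeasure f) n)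
  have hs : ∀ θ, risk θ ≤ s := fun θ => le_iSup₂_of_le (cubeDensity m γ θ) (hmem θ) le_rfl
  have hA : ∑ θ, ∑ j, a θ j ≤ 2 ^ m * s := by
    refine (Finset.sum_le_sum fun θ _ => (hrisk θ).trans (hs θ)).trans_eq ?_
    simp
  have hflip : ∑ θ, ∑ j, a (flipAt j θ) j = ∑ θ, ∑ j, a θ j :=
    Finset.sum_comm.trans ((Finset.sum_congr rfl fun j _ =>
      sum_flipAt j fun θ => a θ j).trans Finset.sum_comm)
  have hmain : w * ENNReal.ofReal (2 ^ m * m / 4) ≤ 2 * (2 ^ m * s) := by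
    calc w * ENNReal.ofReal (2 ^ m * m / 4)
        ≤ w * ENNReal.ofReal (∑ θ, ∑ j, ∫ t, min (l θ t) (l (flipAt j θ) t) ∂μ) := by gcongr
      _ = ∑ θ, ∑ j, w * ENNReal.ofReal (∫ t, min (l θ t) (l (flipAt j θ) t) ∂μ) := by
          have h0 : ∀ θ j, 0 ≤ ∫ t, min (l θ t) (l (flipAt j θ) t) ∂μ := fun θ j =>
            integral_nonneg fun t => le_min (hl0 θ t) (hl0 _ t)
          rw [ENNReal.ofReal_sum_of_nonneg fun θ _ => Finset.sum_nonneg fun j _ => h0 θ j,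
            Finset.mul_sum]
          refine Finset.sum_congr rfl fun θ _ => ?_
          rw [ENNReal.ofReal_sum_of_nonneg fun j _ => h0 θ j, Finset.mul_sum]
      _ ≤ ∑ θ, ∑ j, (a θ j + a (flipAt j θ) j) :=
          Finset.sum_le_sum fun θ _ => Finset.sum_le_sum fun j _ => hpair θ j
      _ = 2 * ∑ θ, ∑ j, a θ j := by
          simp only [Finset.sum_add_distrib, hflip, two_mul]
      _ ≤ 2 * (2 ^ m * s) := by gcongr
  -- The `24` collects the measure `1/(3m)` of a bump set times `m` coordinates, the overlap `1/4`,
  -- and the factor `2` from counting each loss in two pairs.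
  have hconst : w * ENNReal.ofReal (2 ^ m * m / 4)
      = ENNReal.ofReal (2 * 2 ^ m) * ENNReal.ofReal ((γ / 2) ^ h / 24) := by
    rw [hw, ← ENNReal.ofReal_mul (by positivity), ← ENNReal.ofReal_mul (by positivity)]
    congr 1
    field_simp
    ring
  have hpow : (2 : ℝ≥0∞) * (2 ^ m * s) = ENNReal.ofReal (2 * 2 ^ m) * s := by
    rw [ENNReal.ofReal_mul zero_le_two, ENNReal.ofReal_pow zero_le_two, ENNReal.ofReal_ofNat,
      mul_assoc]
  rw [hconst, hpow] at hmain
  exact (ENNReal.mul_le_mul_iff_right (by simp) ENNReal.ofReal_ne_top).1 hmain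

/-- The lower bound for the private minimax risk over Hölder classes. -/
theorem exists_le_minimaxRisk (β L h : ℝ) (hβ : 0 < β) (hβ' : β ≤ 1) (hL : 0 < L) (hh : 1 ≤ h) :
    ∃ c : ℝ, 0 < c ∧ ∀ n : ℕ, 1 ≤ n → ∀ ε : ℝ, 0 ≤ ε →
      ENNReal.ofReal c *
          min 1 (ENNReal.ofReal (n * Psi ε) ^ (-(h * β) / (2 * β + 2)))
        ≤ minimaxRisk.{u} n β L h ε := by
  -- The bound `1/2` gives `γ ≤ 1/2` and `4 * c₀ ^ 2 ≤ 1`; the bound `L / 8` gives the Hölder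
  -- condition, since `2π < 8`.
  set c₀ : ℝ := min (1 / 2) (L / 8) with hc₀
  have hc₀pos : 0 < c₀ := lt_min (by norm_num) (by positivity)
  have hc₀half : c₀ ≤ 1 / 2 := min_le_left _ _
  have hc₀L : c₀ ≤ L / 8 := min_le_right _ _
  refine ⟨(c₀ / 2) ^ h * 2 ^ (-(h * β)) / 24, by positivity, fun n hn ε hε => ?_⟩
  set N : ℝ := n * Psi ε with hN
  have hN0 : 0 ≤ N := mul_nonneg (Nat.cast_nonneg n) (Psi_nonneg ε)
  set s : ℝ := N ^ (2 * β + 2)⁻¹ with hs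
  have hs0 : 0 ≤ s := Real.rpow_nonneg hN0 _
  -- This is the smallest order of `m` with `N ≤ m^{2β+2}`. The maximum with `1` covers small `N`,
  -- including `N = 0`. Rounding up costs at most a factor `2` relative to `max 1 s`, whence `2 ^
  -- (-(h * β))` in the constant.
  set m : ℕ := max 1 ⌈s⌉₊ with hm
  have hm1 : 1 ≤ m := le_max_left _ _
  have hm1R : (1 : ℝ) ≤ m := by exact_mod_cast hm1
  have hm0 : (0 : ℝ) < m := by linarith
  have hsm : s ≤ m := (Nat.le_ceil s).trans (by exact_mod_cast le_max_right _ _)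
  have hms : (m : ℝ) ≤ 2 * max 1 s := by
    rw [hm, Nat.cast_max, Nat.cast_one]
    refine max_le (by linarith [le_max_left 1 s]) ?_
    have := Nat.ceil_lt_add_one hs0
    linarith [le_max_left 1 s, le_max_right 1 s]
  set γ : ℝ := c₀ * (m : ℝ) ^ (-β) with hγ
  have hγ0 : 0 ≤ γ := by positivity
  have hγc : γ ≤ c₀ := mul_le_of_le_one_right hc₀pos.le
    (Real.rpow_le_one_of_one_le_of_nonpos hm1R (by linarith))
  have hγm : γ * (m : ℝ) ^ β = c₀ := by
    rw [hγ, mul_assoc, ← Real.rpow_add hm0, neg_add_cancel, Real.rpow_zero, mul_one]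
  have hmem : ∀ θ, cubeDensity m γ θ ∈ HolderDensities β L := by
    refine cubeDensity_mem_holderDensities hβ hβ' hm1 hγ0 (by linarith) ?_
    rw [mul_assoc, hγm]
    nlinarith [Real.pi_lt_four]
  have hinfo : n * (4 * γ ^ 2 * (m : ℝ)⁻¹ * Psi ε) ≤ m := by
    have h1 : N ≤ (m : ℝ) ^ (2 * β + 2) := by
      have h2 : s ^ (2 * β + 2) = N := by
        rw [hs, ← Real.rpow_mul hN0, inv_mul_cancel₀ (by positivity), Real.rpow_one]
      rw [← h2]
      exact Real.rpow_le_rpow hs0 hsm (by positivity)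
    have h3 : (m : ℝ) ^ (2 * β + 2) = ((m : ℝ) ^ β) ^ 2 * m ^ 2 := by
      rw [Real.rpow_add hm0, mul_comm 2 β, Real.rpow_mul hm0.le, Real.rpow_two, Real.rpow_two]
    have h4 : n * (4 * γ ^ 2 * (m : ℝ)⁻¹ * Psi ε) = 4 * γ ^ 2 * N / m := by
      rw [hN]
      field_simp
    rw [h4, div_le_iff₀ hm0]
    calc 4 * γ ^ 2 * N ≤ 4 * γ ^ 2 * (((m : ℝ) ^ β) ^ 2 * m ^ 2) := by
          rw [← h3]
          gcongr
      _ = 4 * c₀ ^ 2 * m ^ 2 := by rw [← hγm]; ring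
      _ ≤ 1 * m ^ 2 := by
          gcongr
          nlinarith
      _ = m * m := by ring
  refine le_trans ?_ (le_minimaxRisk hm1 (by linarith) hγ0 (hγc.trans hc₀half) hmem hinfo)
  -- The case `s ≤ 1` includes `N = 0`, where the negative power is `∞` and the minimum is `1`. For
  -- `s ≥ 1`, `N` is positive and the extended power is the real one.
  have hmin : min 1 (ENNReal.ofReal N ^ (-(h * β) / (2 * β + 2)))
      ≤ ENNReal.ofReal ((max 1 s) ^ (-(h * β))) := by
    rcases le_total s 1 with h1 | h1
    · rw [max_eq_left h1, Real.one_rpow, ENNReal.ofReal_one]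
      exact min_le_left _ _
    · have hNpos : 0 < N := by
        refine hN0.lt_of_ne fun h0 => ?_
        rw [hs, ← h0, Real.zero_rpow (by positivity)] at h1
        linarith
      rw [max_eq_right h1, ENNReal.ofReal_rpow_of_pos hNpos, hs, ← Real.rpow_mul hN0]
      refine (min_le_right _ _).trans_eq ?_
      congr 2
      field_simp
  refine (mul_le_mul_right hmin _).trans ?_
  rw [← ENNReal.ofReal_mul (by positivity)]
  refine ENNReal.ofReal_le_ofReal ?_
  have h1 : (γ / 2) ^ h = (c₀ / 2) ^ h * (m : ℝ) ^ (-(h * β)) := by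
    rw [hγ, mul_div_right_comm, Real.mul_rpow (by positivity) (by positivity),
      ← Real.rpow_mul hm0.le]
    congr 2
    ring
  have h2 : (2 * max 1 s) ^ (-(h * β)) ≤ (m : ℝ) ^ (-(h * β)) :=
    Real.rpow_le_rpow_of_nonpos hm0 hms (by nlinarith)
  rw [Real.mul_rpow zero_le_two (by positivity)] at h2
  rw [h1]
  calc (c₀ / 2) ^ h * 2 ^ (-(h * β)) / 24 * max 1 s ^ (-(h * β))
      = (c₀ / 2) ^ h * (2 ^ (-(h * β)) * max 1 s ^ (-(h * β))) / 24 := by ring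
    _ ≤ (c₀ / 2) ^ h * (m : ℝ) ^ (-(h * β)) / 24 := by gcongr

end PrivateDensity

end

theorem corollary4 (β L h : ℝ) (hβ : 0 < β) (hβ' : β ≤ 1) (hL : 0 < L) (hh : 1 ≤ h) :
    ∃ c : ℝ, 0 < c ∧ ∀ n : ℕ, 1 ≤ n → ∀ ε : ℝ, 0 ≤ ε →
      ENNReal.ofReal c *
          min 1 (ENNReal.ofReal (n * PrivateDensity.Psi ε) ^ (-(h * β) / (2 * β + 2)))
        ≤ PrivateDensity.minimaxRisk.{u} n β L h ε :=
  PrivateDensity.exists_le_minimaxRisk β L h hβ hβ' hL hh
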